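/- Let $(\Omega,\mathcal F,\mathbb P)$ be a probability space with a filtration $\mathbb F=(\mathcal F_t)_{t\ge 0}$ satisfying the usual conditions, let $T\in[0,\infty)$ be a horizon, and let $P=(P_t)_{t\ge0}$ be an adapted càdlàg process which is uniformly bounded on $[0,T]$: there is a constant $C$ such that almost surely $|P_t|\le C$ for all $t\in[0,T]$. Let $\mathcal S^2$ be the set of optional processes $X$ with $\mathbb E\big[\sup_{0\le t\le T}|X_t|^2\big]<\infty$, and let $\mathcal M^2$ be the set of càdlàg $\mathbb F$-martingales $M$ with $\mathbb E[M_T^2]<\infty$. Proposition. For every $\lambda\in(0,1]$ there exists a pair $(v^\lambda,m^\lambda)\in\mathcal S^2\times\mathcal M^2$ with $m^\lambda_0=0$ such that, almost surely, $\int_0^T\big|\lambda\big(e^{(P_s-v^\lambda_s)/\lambda}-1\big)\big|\,ds<\infty$ and, for all $t\in[0,T]$, $$v^\lambda_t=P_T-(m^\lambda_T-m^\lambda_t)+\int_t^T\lambda\big(e^{(P_s-v^\lambda_s)/\lambda}-1\big)\,ds .$$ It is unique: if $(v',m')\in\mathcal S^2\times\mathcal M^2$ is any pair satisfying the same equation in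 the same sense, then almost surely $v'_t=v^\lambda_t$ and $m'_t-m'_0=m^\lambda_t$ for all $t\in[0,T]$. In particular the solution with $m_0=0$ is unique up to indistinguishability on $[0,T]$. -/

import Mathlib

open MeasureTheory Filter Topology
open scoped NNReal ENNReal

/-- The usual conditions on a filtration `(𝓕_t)_{t ≥ 0}`: it is right-continuous, and `𝓕_0` contains
every subset of a `μ`-null set (`μ s = 0` refers to the outer measure, so completeness of the
underlying probability space is included). -/
structure UsualConditions {Ω : Type*} {mΩ : MeasurableSpace Ω}
    (𝓕 : Filtration ℝ≥0 mΩ) (μ : Measure Ω) : Prop where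
  rightContinuous : 𝓕.IsRightContinuous
  complete : ∀ s : Set Ω, μ s = 0 → MeasurableSet[𝓕 0] s

/-- All paths are right-continuous on `[0, ∞)` and have finite left limits on `(0, ∞)`
(at `t = 0` the left-limit condition is void, as `𝓝[<] 0 = ⊥` in `ℝ≥0`). -/
def IsCadlag {Ω : Type*} (X : ℝ≥0 → Ω → ℝ) : Prop :=
  ∀ ω t, ContinuousWithinAt (fun s => X s ω) (Set.Ici t) t ∧
    ∃ l : ℝ, Tendsto (fun s => X s ω) (𝓝[<] t) (𝓝 l)

/-- The optional σ-algebra on `[0, ∞) × Ω`: the one generated by all adapted càdlàg processes. -/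
@[reducible] def optionalSigma {Ω : Type*} {mΩ : MeasurableSpace Ω}
    (𝓕 : Filtration ℝ≥0 mΩ) : MeasurableSpace (ℝ≥0 × Ω) :=
  MeasurableSpace.generateFrom
    {A | ∃ X : ℝ≥0 → Ω → ℝ, StronglyAdapted 𝓕 X ∧ IsCadlag X ∧
      ∃ B : Set ℝ, MeasurableSet B ∧ A = (fun p : ℝ≥0 × Ω => X p.1 p.2) ⁻¹' B}

/-- An optional process. -/
def IsOptional {Ω : Type*} {mΩ : MeasurableSpace Ω}
    (𝓕 : Filtration ℝ≥0 mΩ) (X : ℝ≥0 → Ω → ℝ) : Prop :=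
  Measurable[optionalSigma 𝓕] (fun p : ℝ≥0 × Ω => X p.1 p.2)

/-- The space `𝒮²`: optional processes with `𝔼[sup_{0 ≤ t ≤ T} |X_t|²] < ∞`. -/
structure MemS2 {Ω : Type*} {mΩ : MeasurableSpace Ω}
    (𝓕 : Filtration ℝ≥0 mΩ) (μ : Measure Ω) (T : ℝ≥0) (X : ℝ≥0 → Ω → ℝ) : Prop where
  optional : IsOptional 𝓕 X
  sq_sup_lt_top : ∫⁻ ω, (⨆ t ∈ Set.Icc (0 : ℝ≥0) T, ‖X t ω‖ₑ ^ 2) ∂μ < ∞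

/-- The space `ℳ²`: (càdlàg) martingales, square-integrable up to the horizon `T`. No normalisation
at time `0` is imposed. -/
structure MemM2 {Ω : Type*} {mΩ : MeasurableSpace Ω}
    (𝓕 : Filtration ℝ≥0 mΩ) (μ : Measure Ω) (T : ℝ≥0) (M : ℝ≥0 → Ω → ℝ) : Prop where
  martingale : Martingale M 𝓕 μ
  cadlag : IsCadlag M
  memLp : MemLp (M T) 2 μ

/-- The driver `λ (e^{(p - x)/λ} - 1)`. -/
noncomputable def entropyDriver (lam p x : ℝ) : ℝ :=
  lam * (Real.exp ((p - x) / lam) - 1)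

/-- The pair `(v, m)` satisfies, almost surely and simultaneously for all `t ∈ [0, T]`,
`v_t = P_T - (m_T - m_t) + ∫_t^T λ (e^{(P_s - v_s)/λ} - 1) ds`, where the time integral is a
genuine (absolutely convergent) Lebesgue integral. -/
def SolvesEntropyBSDE {Ω : Type*} {mΩ : MeasurableSpace Ω} (μ : Measure Ω) (T : ℝ≥0)
    (P : ℝ≥0 → Ω → ℝ) (lam : ℝ) (v m : ℝ≥0 → Ω → ℝ) : Prop :=
  ∀ᵐ ω ∂μ,
    IntervalIntegrable
      (fun s : ℝ => entropyDriver lam (P s.toNNReal ω) (v s.toNNReal ω)) volume 0 T ∧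
    ∀ t : ℝ≥0, t ≤ T →
      v t ω = P T ω - (m T ω - m t ω)
        + ∫ s in (t : ℝ)..T, entropyDriver lam (P s.toNNReal ω) (v s.toNNReal ω)

/-! The driver decreases in `v` but grows exponentially as `v → -∞`, so a contraction argument does
not apply directly. Monotonicity of the driver and boundedness of `P` take its place, both through
one comparison principle, `ae_nonpos_of_backward`: if `dD = dN - h dt` with `N` a martingale, `D_T ≤
0`, and `h ≤ 0` wherever `D ≥ 0`, then `D ≤ 0`. It needs no stochastic calculus. Over one cell `[s,
t]` of a partition, `𝔼[D_s⁺]` exceeds `𝔼[D_t⁺]` by at most the expected increment of `∫ h` on the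
event that `D_t + ∫_s^t h > 0`, because the martingale increment averages out over `{D_s > 0} ∈
𝓕_s`. Summed over ever finer partitions these excesses have limit at most zero: `h` is positive only
where `D < 0`, and by right-continuity small cells around such times are not counted.

Uniqueness (`SolvesEntropyBSDE.ae_unique`) is comparison applied to the difference of two solutions,
in both orders. The dominating variable comes from the equation itself, since the driver is bounded
below by `-λ`.

For existence, both arguments of the driver are clipped to `[-C, C]`, which makes it bounded and
Lipschitz. The Picard map then halves distances weighted by `e^{2L(T-t)}`, since conditional
expectation preserves almost sure bounds; this gives `exists_lipschitz_bsde`. Comparison with the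
constants `C` and `-C` shows that the solution stays in `[-C, C]`, where clipping changes nothing.
The càdlàg martingales come from `exists_cadlag_condExp`: Doob's upcrossing inequality yields right
limits along the dyadics, and the usual conditions make these limits an adapted version. -/

/-! ### Upcrossings and one-sided limits along the dyadics. -/

/-- The dyadic numbers in `[0, ∞)`. -/
def dyadics : Set ℝ≥0 := {x | ∃ n k : ℕ, x = k / 2 ^ n}

lemma countable_dyadics : dyadics.Countable := by
  have : dyadics = Set.range (fun p : ℕ × ℕ => (p.2 : ℝ≥0) / 2 ^ p.1) := by
    ext x; simp [dyadics, eq_comm]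
  rw [this]
  exact Set.countable_range _

lemma exists_dyadic_between {s t : ℝ≥0} (hst : s < t) : ∃ d ∈ dyadics, s < d ∧ d < t := by
  obtain ⟨n, hn⟩ := exists_nat_gt (1 / (t - s))
  have hts : 0 < t - s := tsub_pos_of_lt hst
  have h2 : 0 < (2 : ℝ≥0) ^ n := by positivity
  have hn' : 1 / (t - s) < 2 ^ n := hn.trans (by exact_mod_cast Nat.lt_two_pow_self)
  have h1 : 1 < 2 ^ n * (t - s) := by rwa [div_lt_iff₀ hts] at hn'
  refine ⟨((⌊s * 2 ^ n⌋₊ + 1 : ℕ) : ℝ≥0) / 2 ^ n, ⟨n, _, rfl⟩, ?_, ?_⟩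
  · rw [lt_div_iff₀ h2]
    push_cast
    exact Nat.lt_floor_add_one _
  · rw [div_lt_iff₀ h2]
    push_cast
    calc (⌊s * 2 ^ n⌋₊ : ℝ≥0) + 1 ≤ s * 2 ^ n + 1 := by
          gcongr; exact Nat.floor_le (by positivity)
      _ < s * 2 ^ n + 2 ^ n * (t - s) := by gcongr
      _ = (s + (t - s)) * 2 ^ n := by ring
      _ = t * 2 ^ n := by rw [add_tsub_cancel_of_le hst.le]

/-- `UpChain x a b k l u`: along the dyadics of `[l, u)`, the function `x` crosses `k` times from
below `a` to above `b`. -/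
def UpChain (x : ℝ≥0 → ℝ) (a b : ℝ) : ℕ → ℝ≥0 → ℝ≥0 → Prop
  | 0, l, u => l ≤ u
  | k + 1, l, u => ∃ p ∈ dyadics, ∃ q ∈ dyadics,
      UpChain x a b k l p ∧ p < q ∧ q < u ∧ x p < a ∧ b < x q

/-- Chains are defined by appending crossings at the upper end. Near a right limit point crossings
are found in decreasing order, so they must also be attachable below. -/
lemma UpChain.cons {x : ℝ≥0 → ℝ} {a b : ℝ} {k : ℕ} {p q l u : ℝ≥0} (hp : p ∈ dyadics)
    (hq : q ∈ dyadics) (hpq : p < q) (hql : q < l) (hxp : x p < a) (hxq : b < x q)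
    (h : UpChain x a b k l u) : UpChain x a b (k + 1) p u := by
  induction k generalizing u with
  | zero => exact ⟨p, hp, q, hq, le_refl p, hpq, hql.trans_le h, hxp, hxq⟩
  | succ k ih =>
    obtain ⟨p', hp', q', hq', h1, h2⟩ := h
    exact ⟨p', hp', q', hq', ih h1, h2⟩

/-- Along the dyadics, `x` is bounded and has boundedly many upcrossings of every rational
interval. -/
structure DyadicRegular (K : ℝ) (x : ℝ≥0 → ℝ) : Prop where
  bdd : ∀ q ∈ dyadics, |x q| ≤ K
  up : ∀ a b : ℚ, a < b → ∃ k, ∀ l u, ¬ UpChain x a b k l u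

section Paths

variable {K : ℝ} {x : ℝ≥0 → ℝ}

lemma DyadicRegular.exists_tendsto (hx : DyadicRegular K x) {f : Filter ℝ≥0}
    (hf : dyadics ∈ f)
    (H : ∀ a b : ℚ, (∃ᶠ n in f, x n < a) → (∃ᶠ n in f, b < x n) → ∀ k, ∃ l u, UpChain x a b k l u) :
    ∃ c, Tendsto x f (𝓝 c) := by
  have hb : ∀ᶠ q in f, |x q| ≤ K := by filter_upwards [hf] with q hq using hx.bdd q hq
  refine tendsto_of_no_upcrossings (s := Set.range ((↑) : ℚ → ℝ)) Rat.denseRange_cast ?_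
    ⟨K, by simpa using hb.mono fun q hq => (abs_le.1 hq).2⟩
    ⟨-K, by simpa using hb.mono fun q hq => (abs_le.1 hq).1⟩
  rintro _ ⟨a, rfl⟩ _ ⟨b, rfl⟩ hab ⟨ha, hb⟩
  obtain ⟨k, hk⟩ := hx.up a b (by exact_mod_cast hab)
  obtain ⟨l, u, h⟩ := H a b ha hb k
  exact hk l u h

lemma DyadicRegular.exists_tendsto_right (hx : DyadicRegular K x) (t : ℝ≥0) :
    ∃ c, Tendsto x (𝓝[Set.Ioi t ∩ dyadics] t) (𝓝 c) := by
  refine hx.exists_tendsto (mem_of_superset self_mem_nhdsWithin Set.inter_subset_right)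
    fun a b ha hb k => ?_
  have key : ∀ P : ℝ≥0 → Prop, (∃ᶠ n in 𝓝[Set.Ioi t ∩ dyadics] t, P n) → ∀ u > t,
      ∃ q ∈ dyadics, t < q ∧ q < u ∧ P q := by
    intro P hP u hu
    have : ∀ᶠ q in 𝓝[Set.Ioi t ∩ dyadics] t, q ∈ Set.Ioi t ∩ dyadics ∧ q < u :=
      (eventually_mem_nhdsWithin).and (mem_nhdsWithin_of_mem_nhds (Iio_mem_nhds hu))
    obtain ⟨q, hq, ⟨h1, h2⟩, h3⟩ := (hP.and_eventually this).exists
    exact ⟨q, h2, h1, h3, hq⟩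
  -- Keeping the lower end strictly above `t` leaves room for the next crossing between `t` and `l`.
  have : ∀ u > t, ∃ l > t, UpChain x a b k l u := by
    induction k with
    | zero => exact fun u hu => ⟨u, hu, le_refl u⟩
    | succ k ih =>
      intro u hu
      obtain ⟨l, hl, hc⟩ := ih u hu
      obtain ⟨q, hq, h1, h2, h3⟩ := key _ hb l hl
      obtain ⟨p, hp, h4, h5, h6⟩ := key _ ha q h1
      exact ⟨p, h4, hc.cons hp hq h5 h2 h6 h3⟩
  obtain ⟨l, -, h⟩ := this (t + 1) (by simp)
  exact ⟨l, _, h⟩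

lemma DyadicRegular.exists_tendsto_left (hx : DyadicRegular K x) (t : ℝ≥0) :
    ∃ c, Tendsto x (𝓝[Set.Iio t ∩ dyadics] t) (𝓝 c) := by
  refine hx.exists_tendsto (mem_of_superset self_mem_nhdsWithin Set.inter_subset_right)
    fun a b ha hb k => ?_
  rcases eq_or_ne t 0 with rfl | ht
  · simp at ha
  have key : ∀ P : ℝ≥0 → Prop, (∃ᶠ n in 𝓝[Set.Iio t ∩ dyadics] t, P n) → ∀ u < t,
      ∃ q ∈ dyadics, u < q ∧ q < t ∧ P q := by
    intro P hP u hu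
    have : ∀ᶠ q in 𝓝[Set.Iio t ∩ dyadics] t, q ∈ Set.Iio t ∩ dyadics ∧ u < q :=
      (eventually_mem_nhdsWithin).and (mem_nhdsWithin_of_mem_nhds (Ioi_mem_nhds hu))
    obtain ⟨q, hq, ⟨h1, h2⟩, h3⟩ := (hP.and_eventually this).exists
    exact ⟨q, h2, h3, h1, hq⟩
  have : ∃ u < t, UpChain x a b k 0 u := by
    induction k with
    | zero => exact ⟨0, ht.bot_lt, le_refl _⟩
    | succ k ih =>
      obtain ⟨u, hu, hc⟩ := ih
      obtain ⟨p, hp, h1, h2, h3⟩ := key _ ha u hu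
      obtain ⟨q, hq, h4, h5, h6⟩ := key _ hb p h2
      -- A chain must end strictly after its last crossing time, yet before `t`.
      obtain ⟨r, hqr, hrt⟩ := exists_between h5
      refine ⟨r, hrt, p, hp, q, hq, ?_, h4, hqr, h3, h6⟩
      have : ∀ k, UpChain x a b k 0 u → UpChain x a b k 0 p := by
        rintro (_ | k) h
        · exact zero_le
        · obtain ⟨p', hp', q', hq', h1', h2', h3', h4'⟩ := h
          exact ⟨p', hp', q', hq', h1', h2', h3'.trans h1, h4'⟩
      exact this k hc
  obtain ⟨u, -, h⟩ := this
  exact ⟨0, u, h⟩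

/-- The right limit along the dyadics. -/
noncomputable def dyadicLim (x : ℝ≥0 → ℝ) (t : ℝ≥0) : ℝ :=
  limUnder (𝓝[Set.Ioi t ∩ dyadics] t) x

instance neBot_nhdsWithin_Ioi_dyadics (t : ℝ≥0) : (𝓝[Set.Ioi t ∩ dyadics] t).NeBot := by
  rw [← mem_closure_iff_nhdsWithin_neBot, mem_closure_iff_nhds]
  intro U hU
  obtain ⟨u, hu, hU'⟩ := exists_Ico_subset_of_mem_nhds hU ⟨t + 1, by simp⟩
  obtain ⟨d, hd, h1, h2⟩ := exists_dyadic_between hu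
  exact ⟨d, hU' ⟨h1.le, h2⟩, h1, hd⟩

lemma DyadicRegular.tendsto_dyadicLim (hx : DyadicRegular K x) (t : ℝ≥0) :
    Tendsto x (𝓝[Set.Ioi t ∩ dyadics] t) (𝓝 (dyadicLim x t)) :=
  tendsto_nhds_limUnder (hx.exists_tendsto_right t)

lemma DyadicRegular.abs_dyadicLim_le (hx : DyadicRegular K x) (t : ℝ≥0) :
    |dyadicLim x t| ≤ K := by
  refine le_of_tendsto (hx.tendsto_dyadicLim t).abs ?_
  filter_upwards [self_mem_nhdsWithin] with q hq using hx.bdd q hq.2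

/-- Transfers closed neighbourhoods from dyadic values to their right limits; right-continuity and
left limits of the regularised path both reduce to it. -/
lemma DyadicRegular.dyadicLim_mem (hx : DyadicRegular K x) {t u : ℝ≥0} (htu : t < u) {A : Set ℝ}
    (hA : IsClosed A) (h : ∀ q ∈ dyadics, t < q → q < u → x q ∈ A) : dyadicLim x t ∈ A := by
  refine hA.mem_of_tendsto (hx.tendsto_dyadicLim t) ?_
  filter_upwards [self_mem_nhdsWithin, mem_nhdsWithin_of_mem_nhds (Iio_mem_nhds htu)] with q hq hqu
  exact h q hq.2 hq.1 hqu

lemma DyadicRegular.continuousWithinAt_dyadicLim (hx : DyadicRegular K x) (t : ℝ≥0) :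
    ContinuousWithinAt (dyadicLim x) (Set.Ici t) t := by
  rw [← continuousWithinAt_Ioi_iff_Ici, ContinuousWithinAt,
    (closed_nhds_basis (dyadicLim x t)).tendsto_right_iff]
  rintro A ⟨hA, hAc⟩
  have := hx.tendsto_dyadicLim t hA
  rw [mem_map, mem_nhdsWithin] at this
  obtain ⟨U, hU, htU, hUA⟩ := this
  obtain ⟨u, hu, hU'⟩ := exists_Ico_subset_of_mem_nhds (hU.mem_nhds htU) ⟨t + 1, by simp⟩
  filter_upwards [Ioo_mem_nhdsGT hu] with s hs
  exact hx.dyadicLim_mem hs.2 hAc fun q hq h1 h2 =>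
    hUA ⟨hU' ⟨(hs.1.trans h1).le, h2⟩, hs.1.trans h1, hq⟩

lemma DyadicRegular.exists_left_lim_dyadicLim (hx : DyadicRegular K x) (t : ℝ≥0) :
    ∃ l, Tendsto (dyadicLim x) (𝓝[<] t) (𝓝 l) := by
  obtain ⟨l, hl⟩ := hx.exists_tendsto_left t
  refine ⟨l, ?_⟩
  rcases eq_or_ne t 0 with rfl | ht
  · simp
  rw [(closed_nhds_basis l).tendsto_right_iff]
  rintro A ⟨hA, hAc⟩
  have := hl hA
  rw [mem_map, mem_nhdsWithin] at this
  obtain ⟨U, hU, htU, hUA⟩ := this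
  obtain ⟨u, hu, hU'⟩ := exists_Ioc_subset_of_mem_nhds (hU.mem_nhds htU) ⟨0, ht.bot_lt⟩
  filter_upwards [Ioo_mem_nhdsLT hu] with s hs
  exact hx.dyadicLim_mem hs.2 hAc fun q hq h1 h2 =>
    hUA ⟨hU' ⟨hs.1.trans h1, h2.le⟩, h2, hq⟩

/-- Chains of upcrossings are seen by the discrete upcrossing counts on fine dyadic grids. -/
lemma UpChain.eventually_le_upcrossingsBefore {Ω : Type*} {X : ℝ≥0 → Ω → ℝ} {ω : Ω} {a b : ℝ}
    (hab : a < b) {k : ℕ} {l u : ℝ≥0} (h : UpChain (fun t => X t ω) a b k l u) :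
    ∀ᶠ n : ℕ in atTop, ∀ N : ℕ, u ≤ (N : ℝ≥0) / 2 ^ n →
      k ≤ upcrossingsBefore a b (fun i : ℕ => X ((i : ℝ≥0) / 2 ^ n)) N ω := by
  induction k generalizing u with
  | zero => simp
  | succ k ih =>
    obtain ⟨p, ⟨np, kp, rfl⟩, q, ⟨nq, kq, rfl⟩, h1, hpq, hqu, hp, hq⟩ := h
    filter_upwards [ih h1, eventually_ge_atTop np, eventually_ge_atTop nq] with n hn hnp hnq N hN
    have conv : ∀ i j : ℕ, j ≤ n → (i : ℝ≥0) / 2 ^ j = ((i * 2 ^ (n - j) : ℕ) : ℝ≥0) / 2 ^ n := by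
      intro i j hj
      rw [div_eq_div_iff (by positivity) (by positivity)]
      push_cast
      rw [mul_assoc, ← pow_add, Nat.sub_add_cancel hj]
    rw [conv kp np hnp] at hpq hp hn
    rw [conv kq nq hnq] at hpq hqu hq
    have h2 : (0 : ℝ≥0) < 2 ^ n := by positivity
    have e1 := (div_lt_div_iff_of_pos_right h2).1 hpq
    have e2 := (div_lt_div_iff_of_pos_right h2).1 (hqu.trans_le hN)
    rw [Nat.cast_lt] at e1 e2
    -- A crossing completed at index `kq * 2 ^ (n - nq)` is counted only before the next index; the
    -- strict inequality `q < u` in `UpChain` provides that extra index.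
    have e3 := upcrossingsBefore_lt_of_exists_upcrossing (ω := ω) hab
      (f := fun i : ℕ => X ((i : ℝ≥0) / 2 ^ n)) le_rfl hp e1.le hq
    have e4 := upcrossingsBefore_mono hab (f := fun i : ℕ => X ((i : ℝ≥0) / 2 ^ n)) e2 ω
    have e5 := hn _ le_rfl
    simp only [Nat.succ_eq_add_one] at e4
    omega

end Paths

/-! ### Càdlàg versions of bounded martingales. -/

section CadlagVersion

variable {Ω : Type*} {mΩ : MeasurableSpace Ω} {μ : Measure Ω} [IsProbabilityMeasure μ]
  {𝓕 : Filtration ℝ≥0 mΩ}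

/-- The restriction of a filtration to the dyadic grid of mesh `2⁻ⁿ`. -/
noncomputable def dyadicFiltration (𝓕 : Filtration ℝ≥0 mΩ) (n : ℕ) : Filtration ℕ mΩ where
  seq i := 𝓕 ((i : ℝ≥0) / 2 ^ n)
  mono' i j hij := 𝓕.mono (by gcongr)
  le' i := 𝓕.le _

/-- Doob's inequality bounds the expected upcrossings on each dyadic grid by a constant independent
of the mesh, so by Fatou their liminf is almost surely finite. Arbitrarily long chains would make it
infinite, as each chain is seen by all sufficiently fine grids. -/
lemma ae_upChain_bounded {ξ : Ω → ℝ} {K : ℝ}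
    (hK : ∀ t, ∀ᵐ ω ∂μ, |(μ[ξ|𝓕 t]) ω| ≤ K) {a b : ℝ} (hab : a < b) :
    ∀ᵐ ω ∂μ, ∃ k, ∀ l u, ¬ UpChain (fun t => (μ[ξ|𝓕 t]) ω) a b k l u := by
  set X : ℝ≥0 → Ω → ℝ := fun t => μ[ξ|𝓕 t]
  set f : ℕ → ℕ → Ω → ℝ := fun n i => X ((i : ℝ≥0) / 2 ^ n)
  have hf : ∀ n, Martingale (f n) (dyadicFiltration 𝓕 n) μ := fun n =>
    martingale_condExp ξ (dyadicFiltration 𝓕 n) μ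
  have hba : 0 < b - a := sub_pos.2 hab
  have hint : ∀ n, ENNReal.ofReal (b - a) * ∫⁻ ω, upcrossings a b (f n) ω ∂μ
      ≤ ENNReal.ofReal (K + |a|) := by
    intro n
    refine ((hf n).submartingale.mul_lintegral_upcrossings_le_lintegral_pos_part a b).trans
      (iSup_le fun N => ?_)
    calc ∫⁻ ω, ENNReal.ofReal ((f n N ω - a)⁺) ∂μ ≤ ∫⁻ _, ENNReal.ofReal (K + |a|) ∂μ := by
          refine lintegral_mono_ae ?_
          filter_upwards [hK ((N : ℝ≥0) / 2 ^ n)] with ω hω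
          refine ENNReal.ofReal_le_ofReal (sup_le ?_ ?_)
          · exact (sub_le_sub_right (le_abs_self _) _).trans
              (by linarith [neg_abs_le a, show |f n N ω| ≤ K from hω])
          · linarith [abs_nonneg a, abs_nonneg (X ((N : ℝ≥0) / 2 ^ n) ω)]
      _ = ENNReal.ofReal (K + |a|) := by simp
  have hmeas : ∀ n, Measurable (upcrossings a b (f n)) := fun n =>
    (hf n).1.measurable_upcrossings hab
  have hlim : ∫⁻ ω, liminf (fun n => upcrossings a b (f n) ω) atTop ∂μ ≠ ∞ := by
    refine ((lintegral_liminf_le hmeas).trans_lt ?_).ne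
    refine lt_of_le_of_lt (liminf_le_of_frequently_le'
      (x := ENNReal.ofReal (K + |a|) / ENNReal.ofReal (b - a)) ?_) ?_
    · refine Frequently.of_forall fun n => ?_
      rw [ENNReal.le_div_iff_mul_le (Or.inl (by simpa using hab)) (Or.inl (by simp)), mul_comm]
      exact hint n
    · exact ENNReal.div_lt_top (by simp) (by simpa using hab)
  filter_upwards [ae_lt_top (.liminf hmeas) hlim] with ω hω
  by_contra! hcon
  refine hω.ne (ENNReal.eq_top_of_forall_nnreal_le fun r => ?_)
  obtain ⟨k, hk⟩ := exists_nat_ge r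
  refine le_trans (by exact_mod_cast hk : (r : ℝ≥0∞) ≤ k) (le_liminf_of_le (by isBoundedDefault) ?_)
  obtain ⟨l, u, hc⟩ := hcon k
  filter_upwards [hc.eventually_le_upcrossingsBefore hab] with n hn
  obtain ⟨N, hN⟩ := exists_nat_ge (u * 2 ^ n)
  have := hn N (by rwa [le_div_iff₀ (by positivity)])
  exact le_trans (Nat.cast_le.2 this)
    (le_iSup (fun N => (upcrossingsBefore a b (f n) N ω : ℝ≥0∞)) N)

lemma ae_dyadicRegular_condExp (𝓕 : Filtration ℝ≥0 mΩ) {ξ : Ω → ℝ} {K : ℝ≥0}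
    (hξ : ∀ᵐ ω ∂μ, |ξ ω| ≤ K) :
    ∀ᵐ ω ∂μ, DyadicRegular K (fun t => (μ[ξ|𝓕 t]) ω) := by
  have hK : ∀ t, ∀ᵐ ω ∂μ, |(μ[ξ|𝓕 t]) ω| ≤ K := fun t => ae_bdd_abs_condExp_of_ae_bdd_abs hξ
  have h1 : ∀ᵐ ω ∂μ, ∀ q ∈ dyadics, |(μ[ξ|𝓕 q]) ω| ≤ K :=
    (ae_ball_iff countable_dyadics).2 fun q _ => hK q
  have h2 : ∀ᵐ ω ∂μ, ∀ a b : ℚ, a < b →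
      ∃ k, ∀ l u, ¬ UpChain (fun t => (μ[ξ|𝓕 t]) ω) a b k l u := by
    simp only [ae_all_iff]
    exact fun a b hab => ae_upChain_bounded hK (by exact_mod_cast hab)
  filter_upwards [h1, h2] with ω h1 h2 using ⟨h1, h2⟩

/-- Under right-continuity of the filtration, measurability may be checked at later times. -/
lemma measurable_of_forall_gt (h𝓕 : 𝓕.IsRightContinuous) {t : ℝ≥0} {f : Ω → ℝ}
    (hf : ∀ j > t, Measurable[𝓕 j] f) : Measurable[𝓕 t] f := by
  intro A hA
  refine h𝓕.measurableSet ?_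
  rw [Filtration.rightCont_eq]
  simp only [MeasurableSpace.measurableSet_iInf]
  exact fun j hj => hf j hj hA

/-- A bounded random variable closes a martingale with everywhere càdlàg, bounded paths. -/
theorem exists_cadlag_condExp (h𝓕 : UsualConditions 𝓕 μ) {ξ : Ω → ℝ} (hm : Measurable ξ)
    {K : ℝ≥0} (hξ : ∀ᵐ ω ∂μ, |ξ ω| ≤ K) :
    ∃ M : ℝ≥0 → Ω → ℝ, IsCadlag M ∧ StronglyAdapted 𝓕 M ∧ (∀ t ω, |M t ω| ≤ K) ∧
      ∀ t, M t =ᵐ[μ] μ[ξ|𝓕 t] := by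
  classical
  set X : ℝ≥0 → Ω → ℝ := fun t => μ[ξ|𝓕 t] with hX
  set G : Set Ω := {ω | DyadicRegular K (fun t => X t ω)} with hG
  have hGae : ∀ᵐ ω ∂μ, ω ∈ G := ae_dyadicRegular_condExp 𝓕 hξ
  have hG0 : ∀ t, MeasurableSet[𝓕 t] G := fun t =>
    𝓕.mono (zero_le (a := t)) _ (MeasurableSet.of_compl (h𝓕.complete _ (mem_ae_iff.1 hGae)))
  have hint : Integrable ξ μ := Integrable.of_bound hm.aestronglyMeasurable K hξ
  set M : ℝ≥0 → Ω → ℝ := fun t => G.indicator fun ω => dyadicLim (fun s => X s ω) t with hM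
  have hlim : ∀ t ω, Tendsto (fun q => G.indicator (X q) ω) (𝓝[Set.Ioi t ∩ dyadics] t)
      (𝓝 (M t ω)) := by
    intro t ω
    by_cases hω : ω ∈ G
    · simpa [hM, hω] using DyadicRegular.tendsto_dyadicLim hω t
    · simp [hM, hω]
  -- For any `j > t` the limit may be taken along `q < j`, hence is `𝓕 j`-measurable;
  -- right-continuity of the filtration then lowers `j` to `t`.
  have hmeas : ∀ t, Measurable[𝓕 t] (M t) := by
    refine fun t => measurable_of_forall_gt h𝓕.rightContinuous fun j hj => ?_
    refine @measurable_of_tendsto_metrizable' Ω ℝ (𝓕 j) _ _ _ _ ℝ≥0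
      (fun q => if q < j then G.indicator (X q) else 0) (M t) (𝓝[Set.Ioi t ∩ dyadics] t) _ _ ?_ ?_
    · intro q
      split_ifs with hq
      · exact ((stronglyMeasurable_condExp.measurable).mono (𝓕.mono hq.le) le_rfl).indicator
          (hG0 j)
      · exact measurable_const
    · rw [tendsto_pi_nhds]
      refine fun ω => (hlim t ω).congr' ?_
      filter_upwards [mem_nhdsWithin_of_mem_nhds (Iio_mem_nhds hj)] with q hq
      simp [Set.mem_Iio.1 hq]
  have hbdd : ∀ t ω, |M t ω| ≤ K := by
    intro t ω
    by_cases hω : ω ∈ G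
    · simpa [hM, hω] using DyadicRegular.abs_dyadicLim_le hω t
    · simp [hM, hω]
  refine ⟨M, fun ω t => ?_, fun t => (hmeas t).stronglyMeasurable, hbdd, fun t => ?_⟩
  · by_cases hω : ω ∈ G
    · simp only [hM, Set.indicator_of_mem hω]
      exact ⟨DyadicRegular.continuousWithinAt_dyadicLim hω t,
        DyadicRegular.exists_left_lim_dyadicLim hω t⟩
    · simp only [hM, Set.indicator_of_notMem hω]
      exact ⟨continuousWithinAt_const, 0, tendsto_const_nhds⟩
  · have hMint : Integrable (M t) μ :=
      Integrable.of_bound ((hmeas t).mono (𝓕.le t) le_rfl).aestronglyMeasurable K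
        (.of_forall (hbdd t))
    refine ae_eq_condExp_of_forall_setIntegral_eq (𝓕.le t) hint (fun _ _ _ => hMint.integrableOn)
      (fun A hA _ => ?_) (hmeas t).stronglyMeasurable.aestronglyMeasurable
    have h1 : Tendsto (fun q => ∫ ω in A, G.indicator (X q) ω ∂μ) (𝓝[Set.Ioi t ∩ dyadics] t)
        (𝓝 (∫ ω in A, M t ω ∂μ)) := by
      refine tendsto_integral_filter_of_dominated_convergence (fun _ => (K : ℝ)) ?_ ?_
        (integrable_const _) (.of_forall (hlim t))
      · exact .of_forall fun q =>
          ((stronglyMeasurable_condExp.mono (𝓕.le q)).indicator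
            (𝓕.le q _ (hG0 q))).aestronglyMeasurable
      · filter_upwards [self_mem_nhdsWithin] with q hq
        refine .of_forall fun ω => ?_
        by_cases hω : ω ∈ G
        · simpa [hω] using DyadicRegular.bdd hω q hq.2
        · simp [hω]
    -- For `A ∈ 𝓕 t` and `q > t` the integral of `X q` over `A` is already that of `ξ`, so the limit
    -- is too.
    refine tendsto_nhds_unique h1 (tendsto_const_nhds.congr' ?_)
    filter_upwards [self_mem_nhdsWithin] with q hq
    rw [← setIntegral_condExp (𝓕.le q) hint (𝓕.mono (le_of_lt hq.1) A hA)]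
    refine integral_congr_ae (ae_restrict_of_ae ?_)
    filter_upwards [hGae] with ω hω
    simp [hω, hX]

end CadlagVersion

/-! ### Pathwise estimates on uniform partitions. -/

/-- The `i`-th point of the uniform partition of `[t, T]` into `n + 1` cells. -/
noncomputable def gridPoint (t T : ℝ≥0) (n i : ℕ) : ℝ≥0 := t + i * ((T - t) / (n + 1))

lemma gridPoint_zero (t T : ℝ≥0) (n : ℕ) : gridPoint t T n 0 = t := by simp [gridPoint]

lemma gridPoint_last {t T : ℝ≥0} (h : t ≤ T) (n : ℕ) : gridPoint t T n (n + 1) = T := by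
  rw [gridPoint, Nat.cast_add_one, mul_div_cancel₀ _ (by positivity), add_tsub_cancel_of_le h]

lemma gridPoint_mono (t T : ℝ≥0) (n : ℕ) : Monotone (gridPoint t T n) := fun i j hij => by
  unfold gridPoint; gcongr

lemma gridPoint_le {t T : ℝ≥0} (h : t ≤ T) {n i : ℕ} (hi : i ≤ n + 1) : gridPoint t T n i ≤ T :=
  (gridPoint_mono t T n hi).trans_eq (gridPoint_last h n)

lemma gridPoint_succ (t T : ℝ≥0) (n i : ℕ) :
    gridPoint t T n (i + 1) = gridPoint t T n i + (T - t) / (n + 1) := by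
  unfold gridPoint; push_cast; ring

section Path

variable {t T : ℝ≥0} {h : ℝ → ℝ} {d : ℝ≥0 → ℝ}

/-- The integrand of the cells of the partition on which `d + ∫ h` is positive. -/
noncomputable def cellIntegrand (t T : ℝ≥0) (h : ℝ → ℝ) (d : ℝ≥0 → ℝ) (n : ℕ) (r : ℝ) : ℝ :=
  ∑ i ∈ Finset.range (n + 1),
    (Set.Ioc (gridPoint t T n i : ℝ) (gridPoint t T n (i + 1))).indicator
      (fun r => if 0 < d (gridPoint t T n (i + 1))
        + ∫ r in (gridPoint t T n i : ℝ)..gridPoint t T n (i + 1), h r then max (h r) 0 else 0) r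

lemma abs_cellIntegrand_le (n : ℕ) (r : ℝ) : |cellIntegrand t T h d n r| ≤ |h r| := by
  have hmono : Monotone fun i => (gridPoint t T n i : ℝ) := fun i j hij =>
    NNReal.coe_le_coe.2 (gridPoint_mono t T n hij)
  unfold cellIntegrand
  by_cases hr : ∃ i ∈ Finset.range (n + 1),
      r ∈ Set.Ioc (gridPoint t T n i : ℝ) (gridPoint t T n (i + 1))
  · obtain ⟨i, hi, hri⟩ := hr
    rw [Finset.sum_eq_single_of_mem i hi, Set.indicator_of_mem hri]
    · split_ifs
      · rcases le_total (h r) 0 with h0 | h0 <;> simp [h0]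
      · simp
    · intro j _ hji
      refine Set.indicator_of_notMem (fun hj => ?_) _
      exact Set.disjoint_left.1 (hmono.pairwise_disjoint_on_Ioc_succ hji) hj hri
  · push Not at hr
    rw [Finset.sum_eq_zero fun i hi => Set.indicator_of_notMem (hr i hi) _]
    simp

/-- If `d r ≥ 0`, the positive part of `h r` vanishes. If `d r < 0`, then on a fine grid the right
endpoint of the cell containing `r` still has `d` well below zero and `∫ h` over the cell is small,
so the cell is not counted. -/
lemma eventually_cellIntegrand_eq_zero (hi : IntervalIntegrable h volume 0 T) (htT : t ≤ T)
    (hd : ∀ r ≤ T, ContinuousWithinAt d (Set.Icc r T) r)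
    (hsign : ∀ r : ℝ≥0, r ≤ T → 0 ≤ d r → h r ≤ 0) {r : ℝ} (hr : r ∈ Set.Ioc (0 : ℝ) T) :
    ∀ᶠ n in atTop, cellIntegrand t T h d n r = 0 := by
  lift r to ℝ≥0 using hr.1.le
  have hrT : r ≤ T := by exact_mod_cast hr.2
  rcases le_or_gt 0 (d r) with h0 | h0
  · refine .of_forall fun n => Finset.sum_eq_zero fun i _ => ?_
    simp [Set.indicator_apply, hsign r hrT h0]
  have hF : ContinuousWithinAt (fun x => ∫ r in (0 : ℝ)..x, h r) (Set.Icc (0 : ℝ) T) r := by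
    have := intervalIntegral.continuousOn_primitive_interval' hi
      (Set.left_mem_uIcc (a := (0 : ℝ)) (b := T))
    rw [Set.uIcc_of_le T.coe_nonneg] at this
    exact this _ ⟨hr.1.le, hr.2⟩
  -- Three errors are added: one for `d` at the right endpoint, two for the primitive of `h` at the
  -- ends of the cell.
  have hε : 0 < - d r / 3 := by linarith
  obtain ⟨δ₁, hδ₁, h1⟩ := Metric.continuousWithinAt_iff.1 (hd r hrT) _ hε
  obtain ⟨δ₂, hδ₂, h2⟩ := Metric.continuousWithinAt_iff.1 hF _ hε
  have hmesh : Tendsto (fun n : ℕ => ((T - t : ℝ≥0) : ℝ) / (n + 1)) atTop (𝓝 0) :=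
    ((tendsto_const_div_atTop_nhds_zero_nat ((T - t : ℝ≥0) : ℝ)).comp
      (tendsto_add_atTop_nat 1)).congr fun n => by simp
  filter_upwards [hmesh.eventually_lt_const (lt_min hδ₁ hδ₂)] with n hn
  refine Finset.sum_eq_zero fun i hin => ?_
  by_cases hri : (r : ℝ) ∈ Set.Ioc (gridPoint t T n i : ℝ) (gridPoint t T n (i + 1))
  swap
  · exact Set.indicator_of_notMem hri _
  rw [Set.indicator_of_mem hri, if_neg]
  have hiT : gridPoint t T n (i + 1) ≤ T := gridPoint_le htT (by simpa using hin)
  have hiT' : gridPoint t T n i ≤ T := gridPoint_le htT (by simp at hin; omega)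
  have hstep : (gridPoint t T n (i + 1) : ℝ)
      = gridPoint t T n i + ((T - t : ℝ≥0) : ℝ) / (n + 1) := by
    rw [gridPoint_succ]; push_cast; ring
  have hd1 := h1 (x := gridPoint t T n (i + 1)) ⟨by exact_mod_cast hri.2, hiT⟩ (by
    rw [NNReal.dist_eq, abs_of_nonneg (by linarith [hri.2])]
    linarith [hri.1, min_le_left δ₁ δ₂])
  have hd2 := h2 (x := gridPoint t T n (i + 1)) ⟨NNReal.coe_nonneg _, by exact_mod_cast hiT⟩ (by
    rw [Real.dist_eq, abs_of_nonneg (by linarith [hri.2])]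
    linarith [hri.1, min_le_right δ₁ δ₂])
  have hd3 := h2 (x := gridPoint t T n i) ⟨NNReal.coe_nonneg _, by exact_mod_cast hiT'⟩ (by
    rw [Real.dist_eq, abs_sub_comm, abs_of_nonneg (by linarith [hri.1])]
    linarith [hri.2, min_le_right δ₁ δ₂])
  have hsub : ∀ x ∈ Set.Icc (0 : ℝ) T, IntervalIntegrable h volume 0 x := fun x hx =>
    hi.mono_set (by rw [Set.uIcc_of_le hx.1, Set.uIcc_of_le T.coe_nonneg]; exact Set.Icc_subset_Icc_right hx.2)
  rw [← intervalIntegral.integral_interval_sub_left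
    (hsub _ ⟨NNReal.coe_nonneg _, by exact_mod_cast hiT⟩)
    (hsub _ ⟨NNReal.coe_nonneg _, by exact_mod_cast hiT'⟩)]
  rw [Real.dist_eq, abs_lt] at hd1 hd2 hd3
  linarith [hd1.2, hd2.2, hd3.1]

/-- The sum of the increments `∫ h` over those cells on which `d + ∫ h` is positive. -/
noncomputable def cellSum (t T : ℝ≥0) (h : ℝ → ℝ) (d : ℝ≥0 → ℝ) (n : ℕ) : ℝ :=
  ∑ i ∈ Finset.range (n + 1),
    if 0 < d (gridPoint t T n (i + 1))
        + ∫ r in (gridPoint t T n i : ℝ)..gridPoint t T n (i + 1), h r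
    then ∫ r in (gridPoint t T n i : ℝ)..gridPoint t T n (i + 1), h r else 0

lemma cellSum_le (hi : IntervalIntegrable h volume 0 T) (htT : t ≤ T) (n : ℕ) :
    cellSum t T h d n ≤ ∫ r in Set.Ioc (0 : ℝ) T, cellIntegrand t T h d n r := by
  rw [intervalIntegrable_iff_integrableOn_Ioc_of_le T.coe_nonneg] at hi
  have hpos : IntegrableOn (fun r => max (h r) 0) (Set.Ioc (0 : ℝ) T) := hi.pos_part
  unfold cellIntegrand
  rw [integral_finsetSum]
  swap
  · refine fun i _ => Integrable.indicator ?_ measurableSet_Ioc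
    split_ifs
    exacts [hpos, integrable_zero _ _ _]
  refine Finset.sum_le_sum fun i hin => ?_
  have hsub : Set.Ioc (gridPoint t T n i : ℝ) (gridPoint t T n (i + 1)) ⊆ Set.Ioc (0 : ℝ) T :=
    Set.Ioc_subset_Ioc (NNReal.coe_nonneg _)
      (by exact_mod_cast gridPoint_le htT (by simpa using hin))
  have hle : (gridPoint t T n i : ℝ) ≤ gridPoint t T n (i + 1) := by
    exact_mod_cast gridPoint_mono t T n i.le_succ
  rw [setIntegral_indicator measurableSet_Ioc, Set.inter_eq_self_of_subset_right hsub]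
  split_ifs
  · rw [intervalIntegral.integral_of_le hle]
    exact setIntegral_mono (hi.mono_set hsub) (hpos.mono_set hsub) fun r => le_max_left _ _
  · simp

lemma posPart_cellSum_le (hi : IntervalIntegrable h volume 0 T) (htT : t ≤ T) (n : ℕ) :
    max (cellSum t T h d n) 0 ≤ ∫ r in (0 : ℝ)..T, |h r| := by
  have hi' := (intervalIntegrable_iff_integrableOn_Ioc_of_le T.coe_nonneg).1 hi
  rw [intervalIntegral.integral_of_le T.coe_nonneg]
  refine max_le ((cellSum_le hi htT n).trans ?_) (integral_nonneg fun _ => abs_nonneg _)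
  refine integral_mono_of_nonneg (.of_forall fun r => ?_) hi'.abs
    (.of_forall fun r => (le_abs_self _).trans (abs_cellIntegrand_le n r))
  refine Finset.sum_nonneg fun i _ => Set.indicator_nonneg (fun r _ => ?_) _
  split_ifs
  exacts [le_max_right _ _, le_rfl]

lemma tendsto_posPart_cellSum (hi : IntervalIntegrable h volume 0 T) (htT : t ≤ T)
    (hd : ∀ r ≤ T, ContinuousWithinAt d (Set.Icc r T) r)
    (hsign : ∀ r : ℝ≥0, r ≤ T → 0 ≤ d r → h r ≤ 0) :
    Tendsto (fun n => max (cellSum t T h d n) 0) atTop (𝓝 0) := by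
  have hi' := (intervalIntegrable_iff_integrableOn_Ioc_of_le T.coe_nonneg).1 hi
  have hpos : IntegrableOn (fun r => max (h r) 0) (Set.Ioc (0 : ℝ) T) := hi'.pos_part
  have key : Tendsto (fun n => ∫ r in Set.Ioc (0 : ℝ) T, cellIntegrand t T h d n r) atTop
      (𝓝 (∫ r in Set.Ioc (0 : ℝ) T, (0 : ℝ))) := by
    refine tendsto_integral_of_dominated_convergence (fun r => |h r|) (fun n => ?_) hi'.abs
      (fun n => .of_forall fun r => abs_cellIntegrand_le n r) ?_
    · refine Finset.aestronglyMeasurable_fun_sum _ fun i _ => ?_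
      refine AEStronglyMeasurable.indicator ?_ measurableSet_Ioc
      split_ifs
      exacts [hpos.aestronglyMeasurable, aestronglyMeasurable_const]
    · filter_upwards [ae_restrict_mem measurableSet_Ioc] with r hr
      exact tendsto_const_nhds.congr'
        ((eventually_cellIntegrand_eq_zero hi htT hd hsign hr).mono fun n hn => hn.symm)
  have key' := key.max (tendsto_const_nhds (x := (0 : ℝ)))
  simp only [integral_zero, max_self] at key'
  exact squeeze_zero (fun n => le_max_right _ _)
    (fun n => max_le_max (cellSum_le hi htT n) le_rfl) key'

end Path

/-! ### The comparison principle. -/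

section Comparison

variable {Ω : Type*} {mΩ : MeasurableSpace Ω} {μ : Measure Ω} [IsProbabilityMeasure μ]
  {𝓕 : Filtration ℝ≥0 mΩ} {T : ℝ≥0} {D N : ℝ≥0 → Ω → ℝ}

/-- On `{0 < D s}`, which lies in `𝓕 s`, the martingale increment integrates to zero, so `D s` may
be replaced by `D t + a`, with `a` the drift increment. Then `D t + a` is at most `(D t)⁺ + a` where
it is positive, and at most `(D t)⁺` elsewhere. -/
lemma integral_posPart_le_step (hN : Martingale N 𝓕 μ)
    (hDm : ∀ t ≤ T, Measurable[𝓕 t] (D t)) (hDi : ∀ t ≤ T, Integrable (D t) μ)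
    {s t : ℝ≥0} (hst : s ≤ t) (htT : t ≤ T) :
    ∫ ω, max (D s ω) 0 ∂μ ≤ ∫ ω, max (D t ω) 0 ∂μ
      + ∫ ω, (if 0 < D t ω + (D s ω - D t ω - (N s ω - N t ω))
          then D s ω - D t ω - (N s ω - N t ω) else 0) ∂μ := by
  set a : Ω → ℝ := fun ω => D s ω - D t ω - (N s ω - N t ω) with ha
  have hsT := hst.trans htT
  have hDs := (hDm s hsT).mono (𝓕.le s) le_rfl
  have hDt := (hDm t htT).mono (𝓕.le t) le_rfl
  have hNm : ∀ t, Measurable (N t) := fun t => ((hN.1 t).mono (𝓕.le t)).measurable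
  have ham : Measurable a := (hDs.sub hDt).sub ((hNm s).sub (hNm t))
  have hai : Integrable a μ :=
    ((hDi s hsT).sub (hDi t htT)).sub ((hN.integrable s).sub (hN.integrable t))
  have hPm : MeasurableSet {ω | 0 < D t ω + a ω} :=
    measurableSet_lt measurable_const (hDt.add ham)
  have hJi : Integrable (fun ω => if 0 < D t ω + a ω then a ω else 0) μ := by
    have := hai.indicator hPm
    refine this.congr (.of_forall fun ω => ?_)
    simp [Set.indicator_apply]
  set S : Set Ω := {ω | 0 < D s ω} with hS
  have hSm : MeasurableSet[𝓕 s] S := @measurableSet_lt _ _ _ _ _ (𝓕 s) _ _ _ _ _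
    measurable_const (hDm s hsT)
  have hSm' := 𝓕.le s _ hSm
  have e1 : ∫ ω, max (D s ω) 0 ∂μ = ∫ ω in S, D s ω ∂μ := by
    rw [← integral_indicator hSm']
    refine integral_congr_ae (.of_forall fun ω => ?_)
    by_cases hω : ω ∈ S
    · have : 0 < D s ω := hω
      simp [hω, this.le]
    · have : D s ω ≤ 0 := not_lt.1 hω
      simp [hω, this]
  have e2 : ∫ ω in S, D s ω ∂μ = ∫ ω in S, (D t ω + a ω) ∂μ := by
    have h1 : ∀ ω, D s ω = (D t ω + a ω) + (N s ω - N t ω) := fun ω => by simp only [ha]; ring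
    have h2 := hN.setIntegral_eq hst hSm
    calc ∫ ω in S, D s ω ∂μ = ∫ ω in S, ((D t ω + a ω) + (N s ω - N t ω)) ∂μ := by simp_rw [← h1]
      _ = ∫ ω in S, (D t ω + a ω) ∂μ + ∫ ω in S, (N s ω - N t ω) ∂μ :=
        integral_add ((hDi t htT).add hai).integrableOn
          ((hN.integrable s).sub (hN.integrable t)).integrableOn
      _ = _ := by
        rw [integral_sub (hN.integrable s).integrableOn (hN.integrable t).integrableOn, h2]
        ring
  rw [e1, e2, ← integral_add (hDi t htT).pos_part hJi, ← integral_indicator hSm']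
  refine integral_mono (((hDi t htT).add hai).indicator hSm') ((hDi t htT).pos_part.add hJi)
    fun ω => ?_
  simp only [Set.indicator_apply]
  split_ifs with h1 h2 h2 <;>
    linarith [le_max_left (D t ω) 0, le_max_right (D t ω) 0, show a ω = _ from rfl]

lemma integral_posPart_le_sum (hN : Martingale N 𝓕 μ)
    (hDm : ∀ t ≤ T, Measurable[𝓕 t] (D t)) (hDi : ∀ t ≤ T, Integrable (D t) μ)
    (τ : ℕ → ℝ≥0) (hτ : Monotone τ) (n : ℕ) (hτT : τ n ≤ T) :
    ∫ ω, max (D (τ 0) ω) 0 ∂μ ≤ ∫ ω, max (D (τ n) ω) 0 ∂μ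
      + ∑ i ∈ Finset.range n, ∫ ω, (if 0 < D (τ (i + 1)) ω
            + (D (τ i) ω - D (τ (i + 1)) ω - (N (τ i) ω - N (τ (i + 1)) ω))
          then D (τ i) ω - D (τ (i + 1)) ω - (N (τ i) ω - N (τ (i + 1)) ω) else 0) ∂μ := by
  induction n with
  | zero => simp
  | succ n ih =>
    have h1 := ih ((hτ n.le_succ).trans hτT)
    have h2 := integral_posPart_le_step hN hDm hDi (hτ n.le_succ) hτT
    rw [Finset.sum_range_succ]
    linarith

/-- Comparison principle: `D` solves a backward equation with terminal value `≤ 0` whose driver is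
nonpositive wherever `D ≥ 0`; then `D ≤ 0`. -/
theorem ae_nonpos_of_backward (hN : Martingale N 𝓕 μ)
    (hNr : ∀ ω t, ContinuousWithinAt (fun s => N s ω) (Set.Ici t) t)
    (hDm : ∀ t ≤ T, Measurable[𝓕 t] (D t)) (hDi : ∀ t ≤ T, Integrable (D t) μ)
    {h : Ω → ℝ → ℝ} {B : Ω → ℝ} (hB : Integrable B μ)
    (hh : ∀ᵐ ω ∂μ, IntervalIntegrable (h ω) volume 0 T)
    (hhB : ∀ᵐ ω ∂μ, ∫ r in (0 : ℝ)..T, |h ω r| ≤ B ω)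
    (heq : ∀ᵐ ω ∂μ, ∀ s t : ℝ≥0, s ≤ t → t ≤ T →
      D s ω - D t ω = N s ω - N t ω + ∫ r in (s : ℝ)..t, h ω r)
    (hsign : ∀ᵐ ω ∂μ, ∀ r : ℝ≥0, r ≤ T → 0 ≤ D r ω → h ω r ≤ 0)
    (hT : ∀ᵐ ω ∂μ, D T ω ≤ 0) : ∀ᵐ ω ∂μ, ∀ t ≤ T, D t ω ≤ 0 := by
  -- Right-continuity of `D` is not assumed; the equation transfers it from `N` and the primitive of
  -- `h`.
  have hcont : ∀ᵐ ω ∂μ, ∀ r ≤ T, ContinuousWithinAt (fun t => D t ω) (Set.Icc r T) r := by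
    filter_upwards [hh, heq] with ω h1 h2 r hr
    have hF : ContinuousOn (fun x => ∫ r in (0 : ℝ)..x, h ω r) (Set.Icc (0 : ℝ) T) := by
      have := intervalIntegral.continuousOn_primitive_interval' h1
        (Set.left_mem_uIcc (a := (0 : ℝ)) (b := T))
      rwa [Set.uIcc_of_le T.coe_nonneg] at this
    have hF' : ContinuousWithinAt (fun t : ℝ≥0 => ∫ r in (0 : ℝ)..t, h ω r) (Set.Icc r T) r :=
      ContinuousWithinAt.comp (t := Set.Icc (0 : ℝ) T)
        (hF r ⟨r.coe_nonneg, by exact_mod_cast hr⟩) NNReal.continuous_coe.continuousWithinAt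
        (fun t ht => ⟨t.coe_nonneg, by exact_mod_cast ht.2⟩)
    have h3 : ContinuousWithinAt (fun t => (D 0 ω - N 0 ω) + N t ω - ∫ r in (0 : ℝ)..t, h ω r)
        (Set.Icc r T) r :=
      (continuousWithinAt_const.add ((hNr ω r).mono Set.Icc_subset_Ici_self)).sub hF'
    refine h3.congr (fun t ht => ?_) ?_
    · have := h2 0 t zero_le ht.2
      rw [NNReal.coe_zero] at this
      linarith
    · have := h2 0 r zero_le hr
      rw [NNReal.coe_zero] at this
      linarith
  have hpt : ∀ t ≤ T, ∀ᵐ ω ∂μ, D t ω ≤ 0 := by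
    intro t ht
    -- The cell increments of `∫ h` are written through `D` and `N`, so that their integrability
    -- requires no joint measurability of `h`.
    set J : ℕ → ℕ → Ω → ℝ := fun n i ω =>
      if 0 < D (gridPoint t T n (i + 1)) ω + (D (gridPoint t T n i) ω
          - D (gridPoint t T n (i + 1)) ω
          - (N (gridPoint t T n i) ω - N (gridPoint t T n (i + 1)) ω))
      then D (gridPoint t T n i) ω - D (gridPoint t T n (i + 1)) ω
          - (N (gridPoint t T n i) ω - N (gridPoint t T n (i + 1)) ω) else 0 with hJ
    have hDi' : ∀ n i, i ≤ n + 1 → Integrable (D (gridPoint t T n i)) μ := fun n i hin =>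
      hDi _ (gridPoint_le ht hin)
    have hJi : ∀ n i, i ∈ Finset.range (n + 1) → Integrable (J n i) μ := by
      intro n i hin
      have hin' : i < n + 1 := by simpa using hin
      have hai : Integrable (fun ω => D (gridPoint t T n i) ω - D (gridPoint t T n (i + 1)) ω
          - (N (gridPoint t T n i) ω - N (gridPoint t T n (i + 1)) ω)) μ :=
        ((hDi' n i hin'.le).sub (hDi' n (i + 1) hin')).sub
          ((hN.integrable _).sub (hN.integrable _))
      have hm := (hDi' n (i + 1) hin').1.add hai.1
      have hP : NullMeasurableSet {ω | 0 < D (gridPoint t T n (i + 1)) ω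
          + (D (gridPoint t T n i) ω - D (gridPoint t T n (i + 1)) ω
          - (N (gridPoint t T n i) ω - N (gridPoint t T n (i + 1)) ω))} μ :=
        nullMeasurableSet_lt aemeasurable_const hm.aemeasurable
      refine (hai.indicator₀ hP).congr (.of_forall fun ω => ?_)
      simp [hJ, Set.indicator_apply]
    have hcell : ∀ᵐ ω ∂μ, ∀ n, ∑ i ∈ Finset.range (n + 1), J n i ω
        = cellSum t T (h ω) (fun t => D t ω) n := by
      filter_upwards [heq] with ω hω n
      refine Finset.sum_congr rfl fun i hin => ?_
      have e := hω (gridPoint t T n i) (gridPoint t T n (i + 1))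
        (gridPoint_mono t T n i.le_succ) (gridPoint_le ht (by simpa using hin))
      have e' : D (gridPoint t T n i) ω - D (gridPoint t T n (i + 1)) ω
          - (N (gridPoint t T n i) ω - N (gridPoint t T n (i + 1)) ω)
          = ∫ r in (gridPoint t T n i : ℝ)..gridPoint t T n (i + 1), h ω r := by linarith
      simp only [hJ, e']
    have hlim : Tendsto (fun n => ∫ ω, max (∑ i ∈ Finset.range (n + 1), J n i ω) 0 ∂μ) atTop
        (𝓝 (∫ _, (0 : ℝ) ∂μ)) := by
      refine tendsto_integral_of_dominated_convergence B
        (fun n => (integrable_finsetSum _ (hJi n)).pos_part.1) hB (fun n => ?_) ?_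
      · filter_upwards [hcell, hh, hhB] with ω h1 h2 h3
        rw [h1 n, Real.norm_eq_abs, abs_of_nonneg (le_max_right _ _)]
        exact (posPart_cellSum_le h2 ht n).trans h3
      · filter_upwards [hcell, hh, hcont, hsign] with ω h1 h2 h3 h4
        simp_rw [h1]
        exact tendsto_posPart_cellSum h2 ht h3 h4
    have hle : ∀ n, ∫ ω, max (D t ω) 0 ∂μ
        ≤ ∫ ω, max (∑ i ∈ Finset.range (n + 1), J n i ω) 0 ∂μ := by
      intro n
      have h1 := integral_posPart_le_sum hN hDm hDi (gridPoint t T n) (gridPoint_mono t T n) (n + 1)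
        (gridPoint_last ht n).le
      rw [gridPoint_zero, gridPoint_last ht, ← integral_finsetSum _ (hJi n)] at h1
      have h2 : ∫ ω, max (D T ω) 0 ∂μ = 0 := by
        rw [integral_congr_ae (g := fun _ => 0), integral_zero]
        filter_upwards [hT] with ω hω using max_eq_right hω
      rw [h2, zero_add] at h1
      exact h1.trans (integral_mono (integrable_finsetSum _ (hJi n))
        (integrable_finsetSum _ (hJi n)).pos_part fun ω => le_max_left _ _)
    have h0 : ∫ ω, max (D t ω) 0 ∂μ = 0 := by
      refine le_antisymm ?_ (integral_nonneg fun ω => le_max_right _ _)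
      simpa using ge_of_tendsto' hlim hle
    have h0' := (integral_eq_zero_iff_of_nonneg (f := fun ω => max (D t ω) 0)
      (fun ω => le_max_right _ _) (hDi t ht).pos_part).1 h0
    filter_upwards [h0'] with ω hω
    exact (le_max_left _ _).trans_eq hω
  -- One null set serves all dyadic times, and right-continuity extends the bound to all times.
  have hq : ∀ᵐ ω ∂μ, ∀ q ∈ dyadics, q ≤ T → D q ω ≤ 0 := by
    refine (ae_ball_iff countable_dyadics).2 fun q _ => ?_
    by_cases hqT : q ≤ T
    · filter_upwards [hpt q hqT] with ω hω _ using hω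
    · exact .of_forall fun ω h => absurd h hqT
  filter_upwards [hq, hT, hcont] with ω h1 h2 h3 t ht
  rcases ht.eq_or_lt with rfl | ht'
  · exact h2
  have h4 : Tendsto (fun t => D t ω) (𝓝[Set.Ioi t ∩ dyadics] t) (𝓝 (D t ω)) := by
    have : ContinuousWithinAt (fun t => D t ω) (Set.Ici t) t :=
      (continuousWithinAt_Icc_iff_Ici ht').1 (h3 t ht)
    exact this.mono_left (nhdsWithin_mono _ (Set.inter_subset_left.trans Set.Ioi_subset_Ici_self))
  refine le_of_tendsto h4 ?_
  filter_upwards [self_mem_nhdsWithin, mem_nhdsWithin_of_mem_nhds (Iio_mem_nhds ht')] with q hq hqT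
  exact h1 q hq.2 (le_of_lt hqT)

end Comparison

/-! ### Uniqueness for the entropy-regularised equation. -/

section Uniqueness

variable {Ω : Type*} {mΩ : MeasurableSpace Ω} {μ : Measure Ω}
  {𝓕 : Filtration ℝ≥0 mΩ} {T : ℝ≥0}

lemma IsOptional.measurable {X : ℝ≥0 → Ω → ℝ} (hX : IsOptional 𝓕 X) (t : ℝ≥0) :
    Measurable[𝓕 t] (X t) := by
  have h : @Measurable _ _ (𝓕 t) (optionalSigma 𝓕) (fun ω : Ω => (t, ω)) := by
    refine @measurable_generateFrom _ _ (𝓕 t) _ _ ?_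
    rintro _ ⟨Y, hY, -, B, hB, rfl⟩
    exact (hY t).measurable hB
  exact @Measurable.comp _ _ _ (𝓕 t) (optionalSigma 𝓕) _ _ _ hX h

lemma IsCadlag.isOptional {X : ℝ≥0 → Ω → ℝ} (hX : IsCadlag X) (hX' : StronglyAdapted 𝓕 X) :
    IsOptional 𝓕 X := fun B hB =>
  MeasurableSpace.measurableSet_generateFrom ⟨X, hX', hX, B, hB, rfl⟩

lemma MemS2.integrable [IsProbabilityMeasure μ] {X : ℝ≥0 → Ω → ℝ} (hX : MemS2 𝓕 μ T X) {t : ℝ≥0} (ht : t ≤ T) :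
    Integrable (X t) μ := by
  have hm : AEStronglyMeasurable (X t) μ :=
    ((hX.optional.measurable t).mono (𝓕.le t) le_rfl).aestronglyMeasurable
  refine MemLp.integrable (q := 2) (by norm_num) ⟨hm, ?_⟩
  rw [eLpNorm_lt_top_iff_lintegral_rpow_enorm_lt_top (by norm_num) (by norm_num)]
  refine lt_of_le_of_lt (lintegral_mono fun ω => ?_) hX.sq_sup_lt_top
  have : ‖X t ω‖ₑ ^ (2 : ℝ≥0∞).toReal = ‖X t ω‖ₑ ^ 2 := by norm_num
  rw [this]
  exact le_iSup₂ (f := fun s (_ : s ∈ Set.Icc (0 : ℝ≥0) T) => ‖X s ω‖ₑ ^ 2) t ⟨zero_le, ht⟩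

lemma entropyDriver_anti {lam : ℝ} (hlam : 0 < lam) (p : ℝ) : Antitone (entropyDriver lam p) := by
  intro x y hxy
  unfold entropyDriver
  gcongr

/-- The driver is at least `-lam`, so its absolute integral is controlled by its signed integral,
which the equation expresses through integrable variables. No exponential moment of `v` is needed.
-/
lemma abs_entropyDriver_le {lam : ℝ} (hlam : 0 < lam) (p x : ℝ) :
    |entropyDriver lam p x| ≤ entropyDriver lam p x + 2 * lam := by
  have : -lam ≤ entropyDriver lam p x := by
    unfold entropyDriver
    nlinarith [Real.exp_pos ((p - x) / lam)]
  rw [abs_le]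
  constructor <;> linarith

variable {P v m v' m' : ℝ≥0 → Ω → ℝ} {lam : ℝ}

lemma SolvesEntropyBSDE.ae_increment (hs : SolvesEntropyBSDE μ T P lam v m) :
    ∀ᵐ ω ∂μ, ∀ s t : ℝ≥0, s ≤ t → t ≤ T → v s ω - v t ω = m s ω - m t ω
      + ∫ r in (s : ℝ)..t, entropyDriver lam (P r.toNNReal ω) (v r.toNNReal ω) := by
  filter_upwards [hs] with ω ⟨hi, he⟩ s t hst ht
  have hsub : ∀ a b : ℝ≥0, a ≤ T → b ≤ T → IntervalIntegrable
      (fun r : ℝ => entropyDriver lam (P r.toNNReal ω) (v r.toNNReal ω)) volume a b :=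
    fun a b ha hb => hi.mono_set (by
      rw [Set.uIcc_of_le T.coe_nonneg]
      exact Set.uIcc_subset_Icc ⟨a.coe_nonneg, by exact_mod_cast ha⟩
        ⟨b.coe_nonneg, by exact_mod_cast hb⟩)
  rw [he s (hst.trans ht), he t ht, ← intervalIntegral.integral_add_adjacent_intervals
    (hsub s t (hst.trans ht) ht) (hsub t T ht le_rfl)]
  ring

lemma SolvesEntropyBSDE.ae_integral_abs_le (hlam : 0 < lam)
    (hs : SolvesEntropyBSDE μ T P lam v m) :
    ∀ᵐ ω ∂μ, ∫ r in (0 : ℝ)..T, |entropyDriver lam (P r.toNNReal ω) (v r.toNNReal ω)|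
      ≤ (v 0 ω - v T ω) - (m 0 ω - m T ω) + T * (2 * lam) := by
  filter_upwards [hs, hs.ae_increment] with ω ⟨hi, _⟩ hinc
  have h1 := hinc 0 T zero_le le_rfl
  rw [NNReal.coe_zero] at h1
  calc _ ≤ ∫ r in (0 : ℝ)..T,
        (entropyDriver lam (P r.toNNReal ω) (v r.toNNReal ω) + 2 * lam) :=
        intervalIntegral.integral_mono_on T.coe_nonneg hi.abs
          (hi.add intervalIntegrable_const) fun r _ => abs_entropyDriver_le hlam _ _
    _ = _ := by
        rw [intervalIntegral.integral_add hi intervalIntegrable_const]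
        simp
        linarith

variable [IsProbabilityMeasure μ]

/-- One half of uniqueness for the entropy-regularised backward equation. -/
lemma SolvesEntropyBSDE.ae_le (hlam : 0 < lam)
    (hv : MemS2 𝓕 μ T v) (hm : MemM2 𝓕 μ T m) (hs : SolvesEntropyBSDE μ T P lam v m)
    (hv' : MemS2 𝓕 μ T v') (hm' : MemM2 𝓕 μ T m') (hs' : SolvesEntropyBSDE μ T P lam v' m') :
    ∀ᵐ ω ∂μ, ∀ t ≤ T, v' t ω - v t ω ≤ 0 := by
  have hBi : ∀ {v m : ℝ≥0 → Ω → ℝ}, MemS2 𝓕 μ T v → MemM2 𝓕 μ T m → Integrable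
      (fun ω => (v 0 ω - v T ω) - (m 0 ω - m T ω) + T * (2 * lam)) μ := fun hv hm =>
    (((hv.integrable zero_le).sub (hv.integrable le_rfl)).sub
      ((hm.martingale.integrable _).sub (hm.martingale.integrable _))).add (integrable_const _)
  refine ae_nonpos_of_backward (D := fun t ω => v' t ω - v t ω) (N := m' - m)
    (h := fun ω r => entropyDriver lam (P r.toNNReal ω) (v' r.toNNReal ω)
      - entropyDriver lam (P r.toNNReal ω) (v r.toNNReal ω))
    (hm'.martingale.sub hm.martingale)
    (fun ω t => (hm'.cadlag ω t).1.sub (hm.cadlag ω t).1)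
    (fun t _ => (hv'.optional.measurable t).sub (hv.optional.measurable t))
    (fun t ht => (hv'.integrable ht).sub (hv.integrable ht))
    ((hBi hv' hm').add (hBi hv hm)) ?_ ?_ ?_ ?_ ?_
  · filter_upwards [hs, hs'] with ω h h' using h'.1.sub h.1
  · filter_upwards [hs, hs', hs.ae_integral_abs_le hlam, hs'.ae_integral_abs_le hlam]
      with ω h h' hb hb'
    calc _ ≤ ∫ r in (0 : ℝ)..T, (|entropyDriver lam (P r.toNNReal ω) (v' r.toNNReal ω)|
          + |entropyDriver lam (P r.toNNReal ω) (v r.toNNReal ω)|) :=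
          intervalIntegral.integral_mono_on T.coe_nonneg (h'.1.sub h.1).abs
            (h'.1.abs.add h.1.abs) fun r _ => abs_sub _ _
      _ ≤ _ := by
          rw [intervalIntegral.integral_add h'.1.abs h.1.abs]
          exact add_le_add hb' hb
  · filter_upwards [hs, hs', hs.ae_increment, hs'.ae_increment] with ω h h' hi hi' s t hst ht
    have hsub : Set.uIcc (s : ℝ) t ⊆ Set.uIcc (0 : ℝ) T := by
      rw [Set.uIcc_of_le T.coe_nonneg]
      exact Set.uIcc_subset_Icc ⟨s.coe_nonneg, by exact_mod_cast hst.trans ht⟩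
        ⟨t.coe_nonneg, by exact_mod_cast ht⟩
    rw [intervalIntegral.integral_sub (h'.1.mono_set hsub) (h.1.mono_set hsub)]
    have e1 := hi s t hst ht
    have e2 := hi' s t hst ht
    simp only [Pi.sub_apply]
    linarith
  -- The sign condition is exactly the monotonicity of the driver.
  · refine .of_forall fun ω r _ hr => ?_
    rw [Real.toNNReal_coe]
    exact sub_nonpos.2 (entropyDriver_anti hlam _ (sub_nonneg.1 hr))
  · filter_upwards [hs, hs'] with ω h h'
    rw [h.2 T le_rfl, h'.2 T le_rfl]
    simp

/-- Uniqueness for the entropy-regularised backward equation. -/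
theorem SolvesEntropyBSDE.ae_unique (hlam : 0 < lam)
    (hv : MemS2 𝓕 μ T v) (hm : MemM2 𝓕 μ T m) (hs : SolvesEntropyBSDE μ T P lam v m)
    (hv' : MemS2 𝓕 μ T v') (hm' : MemM2 𝓕 μ T m') (hs' : SolvesEntropyBSDE μ T P lam v' m') :
    ∀ᵐ ω ∂μ, ∀ t ≤ T, v' t ω = v t ω ∧ m' t ω - m' 0 ω = m t ω - m 0 ω := by
  filter_upwards [hs.ae_le hlam hv hm hv' hm' hs', hs'.ae_le hlam hv' hm' hv hm hs,
    hs.ae_increment, hs'.ae_increment] with ω h1 h2 hi hi'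
  have heq : ∀ t ≤ T, v' t ω = v t ω := fun t ht => le_antisymm
    (sub_nonpos.1 (h1 t ht)) (sub_nonpos.1 (h2 t ht))
  refine fun t ht => ⟨heq t ht, ?_⟩
  have e1 := hi 0 t zero_le ht
  have e2 := hi' 0 t zero_le ht
  have e3 : ∫ r in ((0 : ℝ≥0) : ℝ)..t, entropyDriver lam (P r.toNNReal ω) (v' r.toNNReal ω)
      = ∫ r in ((0 : ℝ≥0) : ℝ)..t, entropyDriver lam (P r.toNNReal ω) (v r.toNNReal ω) := by
    refine intervalIntegral.integral_congr fun r hr => ?_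
    rw [NNReal.coe_zero, Set.uIcc_of_le t.coe_nonneg] at hr
    simp only [heq r.toNNReal ((Real.toNNReal_le_iff_le_coe.2 hr.2).trans ht)]
  rw [e3, heq 0 zero_le, heq t ht] at e2
  linarith

end Uniqueness

/-! ### Measurability and continuity of the drift. -/

lemma measurable_comp_countable {Ω : Type*} [MeasurableSpace Ω] {F : ℕ → Ω → ℝ}
    (hF : ∀ k, Measurable (F k)) {ρ : ℝ≥0 → ℕ} (hρ : Measurable ρ) :
    Measurable fun p : ℝ≥0 × Ω => F (ρ p.1) p.2 := by
  have h1 : Measurable fun q : ℕ × Ω => F q.1 q.2 :=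
    measurable_from_prod_countable_right hF
  exact h1.comp ((hρ.comp measurable_fst).prodMk measurable_snd)

lemma tendsto_floor_add_one_div (s : ℝ≥0) :
    Tendsto (fun n : ℕ => ((⌊s * ((n : ℝ≥0) + 1)⌋₊ : ℝ≥0) + 1) / ((n : ℝ≥0) + 1)) atTop
      (𝓝[≥] s) := by
  have hle : ∀ n : ℕ, s ≤ ((⌊s * ((n : ℝ≥0) + 1)⌋₊ : ℝ≥0) + 1) / ((n : ℝ≥0) + 1) := fun n =>
    (le_div_iff₀ (by positivity)).2 (Nat.lt_floor_add_one _).le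
  refine tendsto_nhdsWithin_iff.2 ⟨?_, .of_forall hle⟩
  have hlim : Tendsto (fun n : ℕ => s + 1 / ((n : ℝ≥0) + 1)) atTop (𝓝 (s + 0)) :=
    tendsto_const_nhds.add tendsto_one_div_add_atTop_nhds_zero_nat
  rw [add_zero] at hlim
  refine tendsto_of_tendsto_of_tendsto_of_le_of_le tendsto_const_nhds hlim hle fun n => ?_
  have h3 : s + 1 / ((n : ℝ≥0) + 1) = (s * (n + 1) + 1) / (n + 1) := by
    rw [add_div, mul_div_cancel_right₀ _ (Nat.cast_add_one_ne_zero n)]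
  simp only [h3]
  gcongr
  exact Nat.floor_le (zero_le)

/-- The path is sampled at the next grid point to the right, which takes countably many values;
right-continuity passes joint measurability to the limit. -/
lemma measurable_of_rightContinuous {Ω : Type*} [MeasurableSpace Ω] {X : ℝ≥0 → Ω → ℝ}
    (hX : ∀ s, Measurable (X s))
    (hr : ∀ ω t, ContinuousWithinAt (fun s => X s ω) (Set.Ici t) t) :
    Measurable fun p : ℝ≥0 × Ω => X p.1 p.2 := by
  have hm : ∀ n : ℕ, Measurable fun p : ℝ≥0 × Ω =>
      X (((⌊p.1 * ((n : ℝ≥0) + 1)⌋₊ : ℝ≥0) + 1) / ((n : ℝ≥0) + 1)) p.2 := fun n =>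
    measurable_comp_countable (F := fun k => X (((k : ℝ≥0) + 1) / ((n : ℝ≥0) + 1)))
      (ρ := fun s => ⌊s * ((n : ℝ≥0) + 1)⌋₊) (fun k => hX _)
      (Nat.measurable_floor.comp (measurable_id.mul_const ((n : ℝ≥0) + 1)))
  refine measurable_of_tendsto_metrizable hm (tendsto_pi_nhds.2 fun p => ?_)
  exact (hr p.2 p.1).tendsto.comp (tendsto_floor_add_one_div p.1)

/-- A continuous driver that is bounded and Lipschitz in the second variable, with constant `L`. -/
structure IsLipschitzDriver (g : ℝ → ℝ → ℝ) (L : ℝ) : Prop where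
  pos : 0 < L
  cont : Continuous fun p : ℝ × ℝ => g p.1 p.2
  bdd : ∀ p x, |g p x| ≤ L
  lip : ∀ p x y, |g p x - g p y| ≤ L * |x - y|

/-- The drift `∫_0^t g(P_s, Z_s) ds`. -/
noncomputable def drift {Ω : Type*} (g : ℝ → ℝ → ℝ) (P Z : ℝ≥0 → Ω → ℝ) (t : ℝ≥0) (ω : Ω) : ℝ :=
  ∫ s in (0 : ℝ)..t, g (P s.toNNReal ω) (Z s.toNNReal ω)

section Drift

variable {Ω : Type*} {mΩ : MeasurableSpace Ω} {g : ℝ → ℝ → ℝ} {L : ℝ} {P Z : ℝ≥0 → Ω → ℝ}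

lemma measurable_driver (hg : IsLipschitzDriver g L)
    (hP : ∀ s, Measurable (P s)) (hPr : ∀ ω t, ContinuousWithinAt (fun s => P s ω) (Set.Ici t) t)
    (hZ : ∀ s, Measurable (Z s)) (hZr : ∀ ω t, ContinuousWithinAt (fun s => Z s ω) (Set.Ici t) t) :
    Measurable fun p : ℝ × Ω => g (P p.1.toNNReal p.2) (Z p.1.toNNReal p.2) := by
  have hm : Measurable fun p : ℝ × Ω => (p.1.toNNReal, p.2) :=
    (measurable_real_toNNReal.comp measurable_fst).prodMk measurable_snd
  exact hg.cont.measurable.comp (((measurable_of_rightContinuous hP hPr).comp hm).prodMk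
    ((measurable_of_rightContinuous hZ hZr).comp hm))

lemma measurable_drift_of_measurable (hg : IsLipschitzDriver g L)
    (hP : ∀ s, Measurable (P s)) (hPr : ∀ ω t, ContinuousWithinAt (fun s => P s ω) (Set.Ici t) t)
    (hZ : ∀ s, Measurable (Z s)) (hZr : ∀ ω t, ContinuousWithinAt (fun s => Z s ω) (Set.Ici t) t)
    (t : ℝ≥0) : Measurable (drift g P Z t) := by
  unfold drift
  simp_rw [intervalIntegral.integral_of_le t.coe_nonneg]
  exact ((measurable_driver hg hP hPr hZ hZr).stronglyMeasurable.integral_prod_left').measurable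

lemma continuousWithinAt_min {x : ℝ≥0 → ℝ}
    (hx : ∀ s, ContinuousWithinAt x (Set.Ici s) s) (t s : ℝ≥0) :
    ContinuousWithinAt (fun s => x (min t s)) (Set.Ici s) s :=
  (hx (min t s)).comp (by fun_prop) fun _ hr => min_le_min_left t hr

variable {𝓕 : Filtration ℝ≥0 mΩ}

lemma measurable_drift (hg : IsLipschitzDriver g L) (hP : StronglyAdapted 𝓕 P) (hPc : IsCadlag P)
    (hZ : StronglyAdapted 𝓕 Z) (hZc : IsCadlag Z) (t : ℝ≥0) :
    Measurable[𝓕 t] (drift g P Z t) := by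
  -- The drift up to `t` sees only times at most `t`, so the processes may be frozen at `t`;
  -- everything is then measurable for `𝓕 t` in place of the ambient σ-algebra.
  have h := @measurable_drift_of_measurable Ω (𝓕 t) g L (fun s => P (min t s))
    (fun s => Z (min t s)) hg
    (fun s => ((hP _).mono (𝓕.mono (min_le_left t s))).measurable)
    (fun ω s => continuousWithinAt_min (fun s => (hPc ω s).1) t s)
    (fun s => ((hZ _).mono (𝓕.mono (min_le_left t s))).measurable)
    (fun ω s => continuousWithinAt_min (fun s => (hZc ω s).1) t s) t
  convert h using 1
  ext ω
  refine intervalIntegral.integral_congr fun s hs => ?_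
  rw [Set.uIcc_of_le t.coe_nonneg] at hs
  simp only [min_eq_right (Real.toNNReal_le_iff_le_coe.2 hs.2)]

lemma intervalIntegrable_driver (hg : IsLipschitzDriver g L) (hP : StronglyAdapted 𝓕 P)
    (hPc : IsCadlag P) (hZ : StronglyAdapted 𝓕 Z) (hZc : IsCadlag Z) (ω : Ω) (a b : ℝ) :
    IntervalIntegrable (fun s : ℝ => g (P s.toNNReal ω) (Z s.toNNReal ω)) volume a b := by
  have hm : Measurable fun s : ℝ => g (P s.toNNReal ω) (Z s.toNNReal ω) :=
    (measurable_driver hg (fun s => ((hP s).mono (𝓕.le s)).measurable) (fun ω t => (hPc ω t).1)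
      (fun s => ((hZ s).mono (𝓕.le s)).measurable) (fun ω t => (hZc ω t).1)).comp
      (measurable_id.prodMk measurable_const)
  rw [intervalIntegrable_iff]
  exact Measure.integrableOn_of_bounded (measure_Ioc_lt_top (a := min a b) (b := max a b)).ne hm.aestronglyMeasurable
    (.of_forall fun s => hg.bdd _ _)

lemma continuous_drift (hg : IsLipschitzDriver g L) (hP : StronglyAdapted 𝓕 P)
    (hPc : IsCadlag P) (hZ : StronglyAdapted 𝓕 Z) (hZc : IsCadlag Z) (ω : Ω) :
    Continuous fun t => drift g P Z t ω :=
  (intervalIntegral.continuous_primitive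
    (intervalIntegrable_driver hg hP hPc hZ hZc ω) 0).comp NNReal.continuous_coe

lemma abs_drift_le (hg : IsLipschitzDriver g L) (t : ℝ≥0) (ω : Ω) :
    |drift g P Z t ω| ≤ L * t := by
  have := intervalIntegral.norm_integral_le_of_norm_le_const (a := (0 : ℝ)) (b := t)
    (f := fun s : ℝ => g (P s.toNNReal ω) (Z s.toNNReal ω)) (C := L)
    fun s _ => hg.bdd _ _
  simpa [drift] using this

end Drift

/-! ### The Picard map for a bounded Lipschitz driver. -/

section Picard

variable {Ω : Type*} {mΩ : MeasurableSpace Ω} {μ : Measure Ω} [IsProbabilityMeasure μ]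
  {𝓕 : Filtration ℝ≥0 mΩ} {T : ℝ≥0} {g : ℝ → ℝ → ℝ} {L : ℝ} {P : ℝ≥0 → Ω → ℝ} {ξ : Ω → ℝ}

/-- `Y` is the image of `Z` under the Picard map of the equation with driver `g` and terminal
value `ξ`: `Y_t = 𝔼[ξ + ∫_0^T g(P, Z) | 𝓕_t] - ∫_0^t g(P, Z)`. -/
def IsPicardImage (𝓕 : Filtration ℝ≥0 mΩ) (μ : Measure Ω) (T : ℝ≥0) (g : ℝ → ℝ → ℝ)
    (P : ℝ≥0 → Ω → ℝ) (ξ : Ω → ℝ) (Z Y : ℝ≥0 → Ω → ℝ) : Prop :=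
  ∀ t, ∀ᵐ ω ∂μ, Y t ω = (μ[fun ω => ξ ω + drift g P Z T ω|𝓕 t]) ω - drift g P Z t ω

lemma exists_cadlag_martingale (h𝓕 : UsualConditions 𝓕 μ) (hg : IsLipschitzDriver g L)
    (hP : StronglyAdapted 𝓕 P) (hPc : IsCadlag P) (hξm : Measurable ξ) {K : ℝ≥0}
    (hξ : ∀ ω, |ξ ω| ≤ K) {Z : ℝ≥0 → Ω → ℝ} (hZ : StronglyAdapted 𝓕 Z) (hZc : IsCadlag Z) :
    ∃ M : ℝ≥0 → Ω → ℝ, IsCadlag M ∧ StronglyAdapted 𝓕 M ∧ (∀ t ω, |M t ω| ≤ K + L * T) ∧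
      ∀ t, M t =ᵐ[μ] μ[fun ω => ξ ω + drift g P Z T ω|𝓕 t] := by
  have hb : ∀ ω, |ξ ω + drift g P Z T ω| ≤ (K + L.toNNReal * T : ℝ≥0) := fun ω => by
    simpa [hg.pos.le] using (abs_add_le _ _).trans (add_le_add (hξ ω) (abs_drift_le hg T ω))
  obtain ⟨M, h1, h2, h3, h4⟩ := exists_cadlag_condExp h𝓕
    (hξm.add ((measurable_drift hg hP hPc hZ hZc T).mono (𝓕.le T) le_rfl)) (.of_forall hb)
  exact ⟨M, h1, h2, fun t ω => by simpa [hg.pos.le] using h3 t ω, h4⟩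

lemma IsCadlag.sub_drift (hg : IsLipschitzDriver g L)
    (hP : StronglyAdapted 𝓕 P) (hPc : IsCadlag P) {Z M : ℝ≥0 → Ω → ℝ} (hZ : StronglyAdapted 𝓕 Z)
    (hZc : IsCadlag Z) (hM : IsCadlag M) : IsCadlag fun t ω => M t ω - drift g P Z t ω := by
  intro ω t
  have hd := continuous_drift hg hP hPc hZ hZc ω
  obtain ⟨h1, l, hl⟩ := hM ω t
  exact ⟨h1.sub hd.continuousWithinAt, _, hl.sub (hd.continuousAt.mono_left nhdsWithin_le_nhds)⟩

lemma exists_picardImage (h𝓕 : UsualConditions 𝓕 μ) (hg : IsLipschitzDriver g L)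
    (hP : StronglyAdapted 𝓕 P) (hPc : IsCadlag P) (hξm : Measurable ξ) {K : ℝ≥0}
    (hξ : ∀ ω, |ξ ω| ≤ K) {Z : ℝ≥0 → Ω → ℝ} (hZ : StronglyAdapted 𝓕 Z) (hZc : IsCadlag Z) :
    ∃ Y : ℝ≥0 → Ω → ℝ, IsCadlag Y ∧ StronglyAdapted 𝓕 Y ∧ IsPicardImage 𝓕 μ T g P ξ Z Y ∧
      ∀ t ≤ T, ∀ ω, |Y t ω| ≤ K + 2 * L * T := by
  obtain ⟨M, h1, h2, h3, h4⟩ := exists_cadlag_martingale (T := T) h𝓕 hg hP hPc hξm hξ hZ hZc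
  refine ⟨fun t ω => M t ω - drift g P Z t ω, IsCadlag.sub_drift hg hP hPc hZ hZc h1,
    fun t => (h2 t).sub (measurable_drift hg hP hPc hZ hZc t).stronglyMeasurable, fun t => ?_,
    fun t ht ω => ?_⟩
  · filter_upwards [h4 t] with ω hω
    rw [hω]
  · have e1 := (abs_sub _ _).trans (add_le_add (h3 t ω) (abs_drift_le (P := P) (Z := Z) hg t ω))
    have e2 : L * t ≤ L * T := mul_le_mul_of_nonneg_left (by exact_mod_cast ht) hg.pos.le
    linarith

/-- The rate `2 * L` is chosen so that `L` times the integral of the weight is at most half the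
weight: this is the contraction factor. -/
lemma integral_exp_weight (L c : ℝ) (t T : ℝ) :
    ∫ s in t..T, L * (c * Real.exp (2 * L * (T - s))) =
      c / 2 * Real.exp (2 * L * (T - t)) - c / 2 := by
  have hd : ∀ s, HasDerivAt (fun s => -(c / 2) * Real.exp (2 * L * (T - s)))
      (L * (c * Real.exp (2 * L * (T - s)))) s := by
    intro s
    have h1 : HasDerivAt (fun s => 2 * L * (T - s)) (2 * L * (0 - 1)) s :=
      ((hasDerivAt_const s T).sub (hasDerivAt_id s)).const_mul _
    exact (h1.exp.const_mul (-(c / 2))).congr_deriv (by ring)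
  rw [intervalIntegral.integral_eq_sub_of_hasDerivAt (fun s _ => hd s)
    (Continuous.intervalIntegrable (by fun_prop) _ _)]
  simp
  ring

lemma abs_drift_increment_le (hg : IsLipschitzDriver g L)
    (hP : StronglyAdapted 𝓕 P) (hPc : IsCadlag P) {Z Z' : ℝ≥0 → Ω → ℝ}
    (hZ : StronglyAdapted 𝓕 Z) (hZc : IsCadlag Z) (hZ' : StronglyAdapted 𝓕 Z')
    (hZc' : IsCadlag Z') {c : ℝ} (hc : 0 ≤ c) {ω : Ω}
    (h : ∀ s ≤ T, |Z s ω - Z' s ω| ≤ c * Real.exp (2 * L * (T - s))) {t : ℝ≥0} (ht : t ≤ T) :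
    |(drift g P Z T ω - drift g P Z' T ω) - (drift g P Z t ω - drift g P Z' t ω)|
      ≤ c / 2 * Real.exp (2 * L * (T - t)) := by
  have hi := intervalIntegrable_driver hg hP hPc hZ hZc ω
  have hi' := intervalIntegrable_driver hg hP hPc hZ' hZc' ω
  have e : (drift g P Z T ω - drift g P Z' T ω) - (drift g P Z t ω - drift g P Z' t ω)
      = ∫ s in (t : ℝ)..T, (g (P s.toNNReal ω) (Z s.toNNReal ω)
        - g (P s.toNNReal ω) (Z' s.toNNReal ω)) := by
    rw [intervalIntegral.integral_sub (hi _ _) (hi' _ _),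
      ← intervalIntegral.integral_interval_sub_left (hi 0 T) (hi 0 t),
      ← intervalIntegral.integral_interval_sub_left (hi' 0 T) (hi' 0 t)]
    unfold drift
    ring
  rw [e, ← Real.norm_eq_abs]
  have htT : (t : ℝ) ≤ T := by exact_mod_cast ht
  refine (intervalIntegral.norm_integral_le_of_norm_le htT
    (g := fun s => L * (c * Real.exp (2 * L * (T - s)))) (.of_forall fun s hs => ?_)
    (Continuous.intervalIntegrable (by fun_prop) _ _)).trans ?_
  · have hs0 : 0 ≤ s := t.coe_nonneg.trans hs.1.le
    refine (hg.lip _ _ _).trans (mul_le_mul_of_nonneg_left ?_ hg.pos.le)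
    have := h s.toNNReal (Real.toNNReal_le_iff_le_coe.2 hs.2)
    rwa [Real.coe_toNNReal _ hs0] at this
  · rw [integral_exp_weight]
    linarith

/-- The Picard map halves exponentially weighted distances. -/
lemma IsPicardImage.ae_abs_sub_le (hg : IsLipschitzDriver g L)
    (hP : StronglyAdapted 𝓕 P) (hPc : IsCadlag P) (hξi : Integrable ξ μ) {Z Z' Y Y' : ℝ≥0 → Ω → ℝ}
    (hZ : StronglyAdapted 𝓕 Z) (hZc : IsCadlag Z) (hZ' : StronglyAdapted 𝓕 Z')
    (hZc' : IsCadlag Z') (hYc : IsCadlag Y) (hYc' : IsCadlag Y')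
    (hY : IsPicardImage 𝓕 μ T g P ξ Z Y) (hY' : IsPicardImage 𝓕 μ T g P ξ Z' Y')
    {c : ℝ} (hc : 0 ≤ c)
    (h : ∀ᵐ ω ∂μ, ∀ s ≤ T, |Z s ω - Z' s ω| ≤ c * Real.exp (2 * L * (T - s))) :
    ∀ᵐ ω ∂μ, ∀ t ≤ T, |Y t ω - Y' t ω| ≤ c / 2 * Real.exp (2 * L * (T - t)) := by
  have hdi : ∀ {Z : ℝ≥0 → Ω → ℝ}, StronglyAdapted 𝓕 Z → IsCadlag Z → ∀ t,
      Integrable (drift g P Z t) μ := fun hZ hZc t =>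
    Integrable.of_bound ((measurable_drift hg hP hPc hZ hZc t).mono (𝓕.le t)
      le_rfl).aestronglyMeasurable (L * t) (.of_forall fun ω => abs_drift_le hg t ω)
  have hpt : ∀ t ≤ T, ∀ᵐ ω ∂μ, |Y t ω - Y' t ω| ≤ c / 2 * Real.exp (2 * L * (T - t)) := by
    intro t ht
    have hi : Integrable (fun ω => ξ ω + drift g P Z T ω) μ := hξi.add (hdi hZ hZc T)
    have hi' : Integrable (fun ω => ξ ω + drift g P Z' T ω) μ := hξi.add (hdi hZ' hZc' T)
    have hdt : Integrable (drift g P Z t - drift g P Z' t) μ := (hdi hZ hZc t).sub (hdi hZ' hZc' t)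
    have hdm : StronglyMeasurable[𝓕 t] (drift g P Z t - drift g P Z' t) :=
      (measurable_drift hg hP hPc hZ hZc t).stronglyMeasurable.sub
        (measurable_drift hg hP hPc hZ' hZc' t).stronglyMeasurable
    -- Since the drifts up to `t` are `𝓕 t`-measurable, `Y t - Y' t` is the conditional expectation
    -- of this difference, in which `ξ` cancels, and so inherits its bound.
    have hb : ∀ᵐ ω ∂μ, |((fun ω => ξ ω + drift g P Z T ω) - (fun ω => ξ ω + drift g P Z' T ω)
        - (drift g P Z t - drift g P Z' t)) ω| ≤ c / 2 * Real.exp (2 * L * (T - t)) := by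
      filter_upwards [h] with ω hω
      have := abs_drift_increment_le hg hP hPc hZ hZc hZ' hZc' hc hω ht
      simp only [Pi.sub_apply, add_sub_add_left_eq_sub]
      exact this
    filter_upwards [hY t, hY' t, ae_bdd_abs_condExp_of_ae_bdd_abs (m := 𝓕 t) hb,
      condExp_sub (hi.sub hi') hdt (𝓕 t), condExp_sub hi hi' (𝓕 t)] with ω e1 e2 e3 e4 e5
    rw [e4, Pi.sub_apply, e5, condExp_of_stronglyMeasurable (𝓕.le t) hdm hdt] at e3
    rw [e1, e2]
    refine le_of_eq_of_le (congrArg abs ?_) e3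
    simp only [Pi.sub_apply]
    ring
  have hq : ∀ᵐ ω ∂μ, ∀ q ∈ dyadics, q ≤ T →
      |Y q ω - Y' q ω| ≤ c / 2 * Real.exp (2 * L * (T - q)) := by
    refine (ae_ball_iff countable_dyadics).2 fun q _ => ?_
    by_cases hqT : q ≤ T
    · filter_upwards [hpt q hqT] with ω hω _ using hω
    · exact .of_forall fun ω h => absurd h hqT
  filter_upwards [hq, hpt T le_rfl] with ω h1 h2 t ht
  rcases ht.eq_or_lt with rfl | ht'
  · exact h2
  have h4 : Tendsto (fun s => |Y s ω - Y' s ω|) (𝓝[Set.Ioi t ∩ dyadics] t) (𝓝 |Y t ω - Y' t ω|) :=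
    ((((hYc ω t).1.sub (hYc' ω t).1).mono
      (Set.inter_subset_left.trans Set.Ioi_subset_Ici_self)).tendsto).abs
  have h5 : Tendsto (fun s : ℝ≥0 => c / 2 * Real.exp (2 * L * (T - s)))
      (𝓝[Set.Ioi t ∩ dyadics] t) (𝓝 (c / 2 * Real.exp (2 * L * (T - t)))) :=
    Tendsto.mono_left (Continuous.tendsto (by fun_prop) t) nhdsWithin_le_nhds
  refine le_of_tendsto_of_tendsto h4 h5 ?_
  filter_upwards [self_mem_nhdsWithin, mem_nhdsWithin_of_mem_nhds (Iio_mem_nhds ht')] with q hq hqT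
  exact h1 q hq.2 (le_of_lt hqT)

end Picard

/-! ### Stability of càdlàg paths. -/

section UniformLimit

variable {Ω : Type*}

lemma IsCadlag.of_geometric_limit {F : ℕ → ℝ≥0 → Ω → ℝ} (hF : ∀ n, IsCadlag (F n))
    {Y : ℝ≥0 → Ω → ℝ} {c : ℝ} (h : ∀ n t ω, |F n t ω - Y t ω| ≤ c / 2 ^ n) : IsCadlag Y := by
  have hc : Tendsto (fun n : ℕ => c / 2 ^ n) atTop (𝓝 0) :=
    tendsto_const_nhds.div_atTop (tendsto_pow_atTop_atTop_of_one_lt one_lt_two)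
  intro ω t
  have hu : TendstoUniformly (fun n s => F n s ω) (fun s => Y s ω) atTop := by
    rw [Metric.tendstoUniformly_iff]
    intro ε hε
    filter_upwards [hc.eventually_lt_const hε] with n hn s
    rw [dist_comm]
    exact (h n s ω).trans_lt hn
  constructor
  · refine hu.tendsto_of_eventually_tendsto (L := fun n => F n t ω)
      (.of_forall fun n => (hF n ω t).1) ?_
    exact hu.tendsto_at t
  · choose l hl using fun n => (hF n ω t).2
    rcases (𝓝[<] t).eq_or_neBot with hbot | hbot
    · exact ⟨0, by rw [hbot]; exact tendsto_bot⟩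
    -- The left limits differ by at most `2 * c / 2 ^ n`, written in the shape `_ / 2 / 2 ^ n` of
    -- the geometric Cauchy criterion.
    have hl' : ∀ n, dist (l n) (l (n + 1)) ≤ (4 * c) / 2 / 2 ^ n := by
      intro n
      refine le_of_tendsto ((hl n).dist (hl (n + 1))) (.of_forall fun s => ?_)
      refine (dist_triangle_right _ _ (Y s ω)).trans ?_
      have h1 := h n s ω
      have h2 := h (n + 1) s ω
      have h3 : c / 2 ^ (n + 1) ≤ c / 2 ^ n := by
        have h0 : 0 ≤ c := by simpa using (abs_nonneg _).trans (h 0 s ω)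
        gcongr <;> simp
      have h4 : 4 * c / 2 / 2 ^ n = c / 2 ^ n + c / 2 ^ n := by ring
      rw [h4]
      exact add_le_add h1 (h2.trans h3)
    obtain ⟨a, ha⟩ := cauchySeq_tendsto_of_complete (cauchySeq_of_le_geometric_two hl')
    exact ⟨a, hu.tendsto_of_eventually_tendsto (.of_forall hl) ha⟩

lemma IsCadlag.stopped {X : ℝ≥0 → Ω → ℝ} (hX : IsCadlag X) (T : ℝ≥0) :
    IsCadlag fun t ω => X (min t T) ω := by
  intro ω t
  constructor
  · have := continuousWithinAt_min (fun s => (hX ω s).1) T t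
    simpa only [min_comm T] using this
  · rcases le_or_gt t T with h | h
    · obtain ⟨l, hl⟩ := (hX ω t).2
      refine ⟨l, hl.congr' ?_⟩
      filter_upwards [self_mem_nhdsWithin] with s hs
      rw [min_eq_left (hs.le.trans h)]
    · refine ⟨X T ω, tendsto_const_nhds.congr' ?_⟩
      filter_upwards [mem_nhdsWithin_of_mem_nhds (Ioi_mem_nhds h)] with s hs
      rw [min_eq_right (le_of_lt hs)]

lemma IsCadlag.indicator {X : ℝ≥0 → Ω → ℝ} (hX : IsCadlag X) (G : Set Ω) :
    IsCadlag fun t ω => G.indicator (X t) ω := by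
  intro ω t
  by_cases hω : ω ∈ G
  · simpa [hω] using hX ω t
  · simpa [hω] using ⟨continuousWithinAt_const, 0, tendsto_const_nhds⟩

end UniformLimit

/-! ### The fixed point of the Picard map. -/

section FixedPoint

variable {Ω : Type*} {mΩ : MeasurableSpace Ω} {μ : Measure Ω} [IsProbabilityMeasure μ]
  {𝓕 : Filtration ℝ≥0 mΩ} {T : ℝ≥0} {g : ℝ → ℝ → ℝ} {L : ℝ} {P : ℝ≥0 → Ω → ℝ} {ξ : Ω → ℝ}

/-- A sequence of Picard iterates, converging geometrically. -/
lemma exists_picard_sequence (h𝓕 : UsualConditions 𝓕 μ) (hg : IsLipschitzDriver g L)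
    (hP : StronglyAdapted 𝓕 P) (hPc : IsCadlag P) (hξm : Measurable ξ) {K : ℝ≥0}
    (hξ : ∀ ω, |ξ ω| ≤ K) :
    ∃ Y : ℕ → ℝ≥0 → Ω → ℝ, (∀ n, IsCadlag (Y n)) ∧ (∀ n, StronglyAdapted 𝓕 (Y n)) ∧
      (∀ n, IsPicardImage 𝓕 μ T g P ξ (Y n) (Y (n + 1))) ∧
      ∃ C : ℝ, 0 ≤ C ∧ ∀ᵐ ω ∂μ, ∀ n, ∀ t ≤ T, |Y n t ω - Y (n + 1) t ω| ≤ C / 2 / 2 ^ n := by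
  have hξi : Integrable ξ μ := Integrable.of_bound hξm.aestronglyMeasurable K (.of_forall hξ)
  have hex : ∀ Z : {Z : ℝ≥0 → Ω → ℝ // IsCadlag Z ∧ StronglyAdapted 𝓕 Z},
      ∃ Y : {Z : ℝ≥0 → Ω → ℝ // IsCadlag Z ∧ StronglyAdapted 𝓕 Z},
        IsPicardImage 𝓕 μ T g P ξ Z.1 Y.1 ∧ ∀ t ≤ T, ∀ ω, |Y.1 t ω| ≤ K + 2 * L * T := by
    rintro ⟨Z, hZc, hZ⟩
    obtain ⟨Y, h1, h2, h3, h4⟩ := exists_picardImage (T := T) h𝓕 hg hP hPc hξm hξ hZ hZc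
    exact ⟨⟨Y, h1, h2⟩, h3, h4⟩
  choose Φ hΦ hΦb using hex
  have h0 : IsCadlag (fun (_ : ℝ≥0) (_ : Ω) => (0 : ℝ)) := fun ω t =>
    ⟨continuousWithinAt_const, 0, tendsto_const_nhds⟩
  set Y : ℕ → {Z : ℝ≥0 → Ω → ℝ // IsCadlag Z ∧ StronglyAdapted 𝓕 Z} := fun n =>
    Φ^[n] ⟨fun _ _ => 0, h0, fun _ => stronglyMeasurable_const⟩ with hY
  have hsucc : ∀ n, Y (n + 1) = Φ (Y n) := fun n => Function.iterate_succ_apply' _ _ _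
  have himg : ∀ n, IsPicardImage 𝓕 μ T g P ξ (Y n).1 (Y (n + 1)).1 := fun n => by
    rw [hsucc]; exact hΦ _
  -- The bound on a Picard image does not depend on its argument; for the zero start it gives the
  -- initial distance.
  set R : ℝ := K + 2 * L * T with hR
  have hR0 : 0 ≤ R := by have := hg.pos; positivity
  have hdist : ∀ n, ∀ᵐ ω ∂μ, ∀ t ≤ T, |(Y n).1 t ω - (Y (n + 1)).1 t ω|
      ≤ R / 2 ^ n * Real.exp (2 * L * (T - t)) := by
    intro n
    induction n with
    | zero =>
      refine .of_forall fun ω t ht => ?_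
      have e1 : (Y 0).1 t ω = 0 := rfl
      rw [e1, zero_sub, abs_neg, hsucc, pow_zero, div_one]
      refine (hΦb (Y 0) t ht ω).trans (le_mul_of_one_le_right hR0 (Real.one_le_exp ?_))
      have : (t : ℝ) ≤ T := by exact_mod_cast ht
      have := hg.pos
      exact mul_nonneg (by positivity) (by linarith)
    | succ n ih =>
      have := IsPicardImage.ae_abs_sub_le hg hP hPc hξi (Y n).2.2 (Y n).2.1 (Y (n + 1)).2.2
        (Y (n + 1)).2.1 (Y (n + 1)).2.1 (Y (n + 2)).2.1 (himg n) (himg (n + 1)) (by positivity) ih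
      rwa [div_div, ← pow_succ] at this
  refine ⟨fun n => (Y n).1, fun n => (Y n).2.1, fun n => (Y n).2.2, himg,
    2 * (R * Real.exp (2 * L * T)), by positivity, ?_⟩
  filter_upwards [ae_all_iff.2 hdist] with ω hω n t ht
  refine (hω n t ht).trans ?_
  have h1 : Real.exp (2 * L * (T - t)) ≤ Real.exp (2 * L * T) := by
    refine Real.exp_le_exp.2 (mul_le_mul_of_nonneg_left ?_ (by linarith [hg.pos]))
    linarith [t.coe_nonneg]
  calc R / 2 ^ n * Real.exp (2 * L * (T - t)) ≤ R / 2 ^ n * Real.exp (2 * L * T) := by gcongr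
    _ = _ := by ring

lemma martingale_of_ae_eq_condExp {M : ℝ≥0 → Ω → ℝ} {η : Ω → ℝ} (hM : StronglyAdapted 𝓕 M)
    (h : ∀ t, M t =ᵐ[μ] μ[η|𝓕 t]) : Martingale M 𝓕 μ :=
  ⟨hM, fun s t hst => ((condExp_congr_ae (h t)).trans
    ((martingale_condExp η 𝓕 μ).2 s t hst)).trans (h s).symm⟩

/-- Existence for the backward equation with a bounded Lipschitz driver. -/
theorem exists_lipschitz_bsde (h𝓕 : UsualConditions 𝓕 μ) (hg : IsLipschitzDriver g L)
    (hP : StronglyAdapted 𝓕 P) (hPc : IsCadlag P) (hξm : Measurable[𝓕 T] ξ) {K : ℝ≥0}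
    (hξ : ∀ ω, |ξ ω| ≤ K) :
    ∃ Y m : ℝ≥0 → Ω → ℝ, IsCadlag Y ∧ StronglyAdapted 𝓕 Y ∧ (∀ t ≤ T, Integrable (Y t) μ) ∧
      IsCadlag m ∧ Martingale m 𝓕 μ ∧ (∃ R : ℝ, ∀ t ω, |m t ω| ≤ R) ∧ (∀ ω, m 0 ω = 0) ∧
      ∀ᵐ ω ∂μ, ∀ t ≤ T, Y t ω = ξ ω - (m T ω - m t ω)
        + ∫ s in (t : ℝ)..T, g (P s.toNNReal ω) (Y s.toNNReal ω) := by
  have hξm' : Measurable ξ := hξm.mono (𝓕.le T) le_rfl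
  have hξi : Integrable ξ μ := Integrable.of_bound hξm'.aestronglyMeasurable K (.of_forall hξ)
  obtain ⟨Y, hYc, hYa, hYp, C, hC, hYd⟩ :=
    exists_picard_sequence (T := T) h𝓕 hg hP hPc hξm' hξ
  set G : Set Ω := {ω | ∀ n, ∀ t ≤ T, |Y n t ω - Y (n + 1) t ω| ≤ C / 2 / 2 ^ n} with hG
  have hG0 : ∀ t, MeasurableSet[𝓕 t] G := fun t =>
    𝓕.mono (zero_le (a := t)) _ (MeasurableSet.of_compl (h𝓕.complete _ (mem_ae_iff.1 hYd)))
  -- Freezing at `T` and vanishing off `G` make the geometric estimate hold for every `t` and `ω`,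
  -- so the limit is càdlàg on every path; completeness keeps it adapted.
  set F : ℕ → ℝ≥0 → Ω → ℝ := fun n t => G.indicator fun ω => Y n (min t T) ω with hF
  have hFd : ∀ t ω n, dist (F n t ω) (F (n + 1) t ω) ≤ C / 2 / 2 ^ n := by
    intro t ω n
    by_cases hω : ω ∈ G
    · simpa [hF, hω, Real.dist_eq] using hω n (min t T) (min_le_right _ _)
    · simp only [hF, Set.indicator_of_notMem hω, dist_self]
      positivity
  choose Z hZ using fun t ω => cauchySeq_tendsto_of_complete (cauchySeq_of_le_geometric_two (hFd t ω))
  have hFZ : ∀ n t ω, |F n t ω - Z t ω| ≤ C / 2 ^ n := fun n t ω =>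
    dist_le_of_le_geometric_two_of_tendsto (hFd t ω) (hZ t ω) n
  have hZc : IsCadlag Z :=
    IsCadlag.of_geometric_limit (fun n => ((hYc n).stopped T).indicator G) hFZ
  have hZa : StronglyAdapted 𝓕 Z := fun t =>
    stronglyMeasurable_of_tendsto (f := fun n => F n t) atTop
      (fun n => ((hYa n _).mono (𝓕.mono (min_le_left t T))).indicator (hG0 t))
      (tendsto_pi_nhds.2 (hZ t))
  obtain ⟨M, hMc, hMa, hMb, hM⟩ :=
    exists_cadlag_martingale (T := T) h𝓕 hg hP hPc hξm' hξ hZa hZc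
  have hV : IsPicardImage 𝓕 μ T g P ξ Z fun t ω => M t ω - drift g P Z t ω := fun t => by
    filter_upwards [hM t] with ω hω
    rw [hω]
  have hYZ : ∀ ω ∈ G, ∀ n, ∀ t ≤ T, |Y n t ω - Z t ω| ≤ C / 2 ^ n := by
    intro ω hω n t ht
    simpa [hF, hω, min_eq_left ht] using hFZ n t ω
  -- The iterates converge to `Z` and, by contraction, also to the Picard image of `Z`; hence `Z` is
  -- a fixed point.
  have hYV : ∀ n, ∀ᵐ ω ∂μ, ∀ t ≤ T, |Y (n + 1) t ω - (M t ω - drift g P Z t ω)|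
      ≤ C / 2 ^ n / 2 * Real.exp (2 * L * (T - t)) := by
    intro n
    refine IsPicardImage.ae_abs_sub_le hg hP hPc hξi (hYa n) (hYc n) hZa hZc (hYc (n + 1))
      (IsCadlag.sub_drift hg hP hPc hZa hZc hMc) (hYp n) hV (by positivity) ?_
    filter_upwards [hYd] with ω hω t ht
    refine (hYZ ω hω n t ht).trans (le_mul_of_one_le_right (by positivity) (Real.one_le_exp ?_))
    have : (t : ℝ) ≤ T := by exact_mod_cast ht
    have := hg.pos
    exact mul_nonneg (by positivity) (by linarith)
  have hZV : ∀ᵐ ω ∂μ, ∀ t ≤ T, Z t ω = M t ω - drift g P Z t ω := by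
    filter_upwards [hYd, ae_all_iff.2 hYV] with ω h1 h2 t ht
    have hc : Tendsto (fun n : ℕ => C / 2 ^ n) atTop (𝓝 0) :=
      tendsto_const_nhds.div_atTop (tendsto_pow_atTop_atTop_of_one_lt one_lt_two)
    have l1 : Tendsto (fun n => Y (n + 1) t ω) atTop (𝓝 (Z t ω)) :=
      tendsto_iff_dist_tendsto_zero.2 (squeeze_zero (fun _ => dist_nonneg)
        (fun n => hYZ ω h1 (n + 1) t ht) (hc.comp (tendsto_add_atTop_nat 1)))
    have l2 : Tendsto (fun n => Y (n + 1) t ω) atTop (𝓝 (M t ω - drift g P Z t ω)) := by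
      refine tendsto_iff_dist_tendsto_zero.2 (squeeze_zero (fun _ => dist_nonneg)
        (fun n => h2 n t ht) ?_)
      simpa using (hc.div_const 2).mul_const (Real.exp (2 * L * (T - t)))
    exact tendsto_nhds_unique l1 l2
  have hMm : Martingale M 𝓕 μ := martingale_of_ae_eq_condExp hMa hM
  have hdi : ∀ t, Integrable (drift g P Z t) μ := fun t =>
    Integrable.of_bound ((measurable_drift hg hP hPc hZa hZc t).mono (𝓕.le t)
      le_rfl).aestronglyMeasurable (L * t) (.of_forall fun ω => abs_drift_le hg t ω)
  have hMT : ∀ᵐ ω ∂μ, M T ω = ξ ω + drift g P Z T ω := by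
    have hm : StronglyMeasurable[𝓕 T] fun ω => ξ ω + drift g P Z T ω :=
      (hξm.add (measurable_drift hg hP hPc hZa hZc T)).stronglyMeasurable
    have := hM T
    rwa [condExp_of_stronglyMeasurable (𝓕.le T) hm (hξi.add (hdi T))] at this
  refine ⟨Z, fun t ω => M t ω - M 0 ω, hZc, hZa, fun t ht => ?_, fun ω t => ?_, ?_,
    ⟨(K + L * T) + (K + L * T), fun t ω => ?_⟩, fun ω => sub_self _, ?_⟩
  · refine ((hMm.integrable t).sub (hdi t)).congr ?_
    filter_upwards [hZV] with ω hω
    exact (hω t ht).symm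
  · obtain ⟨h1, l, hl⟩ := hMc ω t
    exact ⟨h1.sub continuousWithinAt_const, _, hl.sub tendsto_const_nhds⟩
  · exact hMm.sub (martingale_const_fun 𝓕 μ (hMa 0) (hMm.integrable 0))
  · exact (abs_sub _ _).trans (add_le_add (hMb t ω) (hMb 0 ω))
  · filter_upwards [hZV, hMT] with ω h1 h2 t ht
    have hi := intervalIntegrable_driver hg hP hPc hZa hZc ω
    rw [← intervalIntegral.integral_interval_sub_left (hi 0 T) (hi 0 t), h1 t ht, h2]
    unfold drift
    ring

end FixedPoint

/-! ### The clipped driver. -/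

/-- Truncation to `[-C, C]`. -/
def clip (C x : ℝ) : ℝ := max (-C) (min C x)

lemma abs_clip_le {C : ℝ} (hC : 0 ≤ C) (x : ℝ) : |clip C x| ≤ C :=
  abs_le.2 ⟨le_max_left _ _, max_le (by linarith) (min_le_left _ _)⟩

lemma clip_of_abs_le {C x : ℝ} (h : |x| ≤ C) : clip C x = x := by
  rw [clip, min_eq_right (abs_le.1 h).2, max_eq_right (abs_le.1 h).1]

lemma abs_clip_sub_clip_le (C x y : ℝ) : |clip C x - clip C y| ≤ |x - y| := by
  have h1 := abs_max_sub_max_le_max (-C) (min C x) (-C) (min C y)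
  have h2 := abs_min_sub_min_le_max C x C y
  rw [sub_self, abs_zero] at h1 h2
  rw [max_eq_right (abs_nonneg (x - y))] at h2
  rw [max_eq_right (abs_nonneg (min C x - min C y))] at h1
  exact h1.trans h2

lemma continuous_clip (C : ℝ) : Continuous (clip C) := by unfold clip; fun_prop

/-- The entropy driver with both variables truncated to `[-C, C]`. -/
noncomputable def clippedDriver (lam C p x : ℝ) : ℝ := entropyDriver lam (clip C p) (clip C x)

lemma abs_exp_sub_exp_le {c u v : ℝ} (hu : u ≤ c) (hv : v ≤ c) :
    |Real.exp u - Real.exp v| ≤ Real.exp c * |u - v| := by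
  have key : ∀ u v : ℝ, u ≤ c → v ≤ u →
      Real.exp u - Real.exp v ≤ Real.exp c * (u - v) := by
    intro u v hu hvu
    have h1 : Real.exp v = Real.exp u * Real.exp (v - u) := by rw [← Real.exp_add]; ring_nf
    have h2 := Real.add_one_le_exp (v - u)
    calc Real.exp u - Real.exp v ≤ Real.exp u * (u - v) := by
          rw [h1]; nlinarith [Real.exp_pos u]
      _ ≤ Real.exp c * (u - v) := by
          gcongr
  rcases le_total v u with h | h
  · rw [abs_of_nonneg (sub_nonneg.2 (Real.exp_le_exp.2 h)), abs_of_nonneg (sub_nonneg.2 h)]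
    exact key u v hu h
  · rw [abs_sub_comm, abs_sub_comm u, abs_of_nonneg (sub_nonneg.2 (Real.exp_le_exp.2 h)),
      abs_of_nonneg (sub_nonneg.2 h)]
    exact key v u hv h

/-- The exponent is at most `2 * C / lam` after clipping. The first summand bounds the driver and
the second is its Lipschitz constant, the factor `1 / lam` being absorbed by `lam`; their sum serves
for both. -/
lemma isLipschitzDriver_clippedDriver {lam C : ℝ} (hlam : 0 < lam) (hC : 0 ≤ C) :
    IsLipschitzDriver (clippedDriver lam C)
      (lam * (Real.exp (2 * C / lam) + 1) + Real.exp (2 * C / lam)) := by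
  have hle : ∀ p x, (clip C p - clip C x) / lam ≤ 2 * C / lam := fun p x => by
    gcongr
    linarith [(abs_le.1 (abs_clip_le hC p)).2, (abs_le.1 (abs_clip_le hC x)).1]
  refine ⟨by positivity, ?_, fun p x => ?_, fun p x y => ?_⟩
  · have := continuous_clip C
    unfold clippedDriver entropyDriver
    fun_prop
  · unfold clippedDriver entropyDriver
    have h1 := Real.exp_le_exp.2 (hle p x)
    have h2 := Real.exp_pos ((clip C p - clip C x) / lam)
    have h3 := Real.exp_pos (2 * C / lam)
    rw [abs_le]
    constructor <;> nlinarith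
  · unfold clippedDriver entropyDriver
    have h1 := abs_exp_sub_exp_le (hle p x) (hle p y)
    have h2 : (clip C p - clip C x) / lam - (clip C p - clip C y) / lam
        = (clip C y - clip C x) / lam := by ring
    rw [h2, abs_div, abs_of_pos hlam, abs_sub_comm (clip C y)] at h1
    calc |lam * (Real.exp ((clip C p - clip C x) / lam) - 1)
          - lam * (Real.exp ((clip C p - clip C y) / lam) - 1)|
        = lam * |Real.exp ((clip C p - clip C x) / lam)
          - Real.exp ((clip C p - clip C y) / lam)| := by
          rw [← mul_sub, sub_sub_sub_cancel_right, abs_mul, abs_of_pos hlam]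
      _ ≤ lam * (Real.exp (2 * C / lam) * (|clip C x - clip C y| / lam)) := by gcongr
      _ = Real.exp (2 * C / lam) * |clip C x - clip C y| := by field_simp
      _ ≤ (lam * (Real.exp (2 * C / lam) + 1) + Real.exp (2 * C / lam)) * |x - y| := by
          have := Real.exp_pos (2 * C / lam)
          refine mul_le_mul ?_ (abs_clip_sub_clip_le C x y) (abs_nonneg _) (by positivity)
          nlinarith

/-- Above `C` the clipped `x` is `C`, which dominates every clipped `p`. This is the sign condition
for comparison with the constant `C`. -/
lemma clippedDriver_nonpos {lam C p x : ℝ} (hlam : 0 < lam) (hC : 0 ≤ C) (hx : C ≤ x) :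
    clippedDriver lam C p x ≤ 0 := by
  have h1 : clip C x = C := by rw [clip, min_eq_left hx, max_eq_right (by linarith)]
  have h2 : Real.exp ((clip C p - C) / lam) ≤ 1 := Real.exp_le_one_iff.2
    (div_nonpos_of_nonpos_of_nonneg (by linarith [(abs_le.1 (abs_clip_le hC p)).2]) hlam.le)
  rw [clippedDriver, entropyDriver, h1]
  exact mul_nonpos_of_nonneg_of_nonpos hlam.le (by linarith)

lemma clippedDriver_nonneg {lam C p x : ℝ} (hlam : 0 < lam) (hC : 0 ≤ C) (hx : x ≤ -C) :
    0 ≤ clippedDriver lam C p x := by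
  have h1 : clip C x = -C := by rw [clip, min_eq_right (by linarith), max_eq_left hx]
  have h2 : 1 ≤ Real.exp ((clip C p - -C) / lam) := Real.one_le_exp
    (div_nonneg (by linarith [(abs_le.1 (abs_clip_le hC p)).1]) hlam.le)
  rw [clippedDriver, entropyDriver, h1]
  exact mul_nonneg hlam.le (by linarith)

/-! ### Existence for the entropy-regularised equation. -/

section Main

variable {Ω : Type*} {mΩ : MeasurableSpace Ω} {μ : Measure Ω} [IsProbabilityMeasure μ]
  {𝓕 : Filtration ℝ≥0 mΩ} {T : ℝ≥0} {P : ℝ≥0 → Ω → ℝ}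

/-- Existence of a bounded solution of the entropy-regularised backward equation. -/
theorem exists_solvesEntropyBSDE (h𝓕 : UsualConditions 𝓕 μ) (hP : StronglyAdapted 𝓕 P)
    (hPc : IsCadlag P) {C : ℝ} (hC : 0 ≤ C) (hPb : ∀ᵐ ω ∂μ, ∀ t ≤ T, |P t ω| ≤ C)
    {lam : ℝ} (hlam : 0 < lam) :
    ∃ v m : ℝ≥0 → Ω → ℝ, MemS2 𝓕 μ T v ∧ MemM2 𝓕 μ T m ∧ (∀ ω, m 0 ω = 0) ∧
      SolvesEntropyBSDE μ T P lam v m := by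
  have hg := isLipschitzDriver_clippedDriver hlam hC
  set L := lam * (Real.exp (2 * C / lam) + 1) + Real.exp (2 * C / lam)
  -- The terminal value is clipped as well, because `|P T| ≤ C` holds only almost surely while the
  -- Lipschitz theorem asks for a bound everywhere.
  obtain ⟨Y, m, hYc, hYa, hYi, hmc, hmm, ⟨R, hR⟩, hm0, heq⟩ := exists_lipschitz_bsde (T := T) h𝓕 hg
    hP hPc (ξ := fun ω => clip C (P T ω)) ((continuous_clip C).measurable.comp (hP T).measurable)
    (K := ⟨C, hC⟩) (fun ω => abs_clip_le hC _)
  have hi := intervalIntegrable_driver hg hP hPc hYa hYc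
  have hinc : ∀ᵐ ω ∂μ, ∀ s t : ℝ≥0, s ≤ t → t ≤ T → Y s ω - Y t ω = m s ω - m t ω
      + ∫ r in (s : ℝ)..t, clippedDriver lam C (P r.toNNReal ω) (Y r.toNNReal ω) := by
    filter_upwards [heq] with ω hω s t hst ht
    rw [hω s (hst.trans ht), hω t ht,
      ← intervalIntegral.integral_add_adjacent_intervals (hi ω s t) (hi ω t T)]
    ring
  have habs : ∀ ω, ∫ r in (0 : ℝ)..T, |clippedDriver lam C (P r.toNNReal ω) (Y r.toNNReal ω)|
      ≤ L * T := fun ω => by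
    calc _ ≤ ∫ r in (0 : ℝ)..T, L := intervalIntegral.integral_mono_on T.coe_nonneg
          (hi ω 0 T).abs intervalIntegrable_const fun r _ => hg.bdd _ _
      _ = L * T := by simp [mul_comm]
  have hYT : ∀ᵐ ω ∂μ, Y T ω = clip C (P T ω) := by
    filter_upwards [heq] with ω hω
    simpa using hω T le_rfl
  have hup : ∀ᵐ ω ∂μ, ∀ t ≤ T, Y t ω - C ≤ 0 := by
    refine ae_nonpos_of_backward (D := fun t ω => Y t ω - C) hmm (fun ω t => (hmc ω t).1)
      (fun t _ => (hYa t).measurable.sub_const C)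
      (fun t ht => (hYi t ht).sub (integrable_const C))
      (integrable_const (L * T)) (.of_forall fun ω => hi ω 0 T) (.of_forall habs) ?_
      (.of_forall fun ω r _ h0 => clippedDriver_nonpos hlam hC ?_) ?_
    · filter_upwards [hinc] with ω hω s t hst ht
      rw [sub_sub_sub_cancel_right]
      exact hω s t hst ht
    · rw [Real.toNNReal_coe]
      exact sub_nonneg.1 h0
    · filter_upwards [hYT] with ω hω
      rw [hω]
      linarith [(abs_le.1 (abs_clip_le hC (P T ω))).2]
  have hlow : ∀ᵐ ω ∂μ, ∀ t ≤ T, -C - Y t ω ≤ 0 := by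
    refine ae_nonpos_of_backward (D := fun t ω => -C - Y t ω) hmm.neg
      (h := fun ω r => -clippedDriver lam C (P r.toNNReal ω) (Y r.toNNReal ω))
      (fun ω t => (hmc ω t).1.neg)
      (fun t _ => (hYa t).measurable.const_sub (-C))
      (fun t ht => (integrable_const (-C)).sub (hYi t ht))
      (integrable_const (L * T)) (.of_forall fun ω => (hi ω 0 T).neg)
      (.of_forall fun ω => ?_) ?_
      (.of_forall fun ω r _ h0 => neg_nonpos.2 (clippedDriver_nonneg hlam hC ?_)) ?_
    · simp_rw [abs_neg]
      exact habs ω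
    · filter_upwards [hinc] with ω hω s t hst ht
      have := hω s t hst ht
      rw [intervalIntegral.integral_neg]
      simp only [Pi.neg_apply]
      linarith
    · rw [Real.toNNReal_coe]
      linarith
    · filter_upwards [hYT] with ω hω
      rw [hω]
      linarith [(abs_le.1 (abs_clip_le hC (P T ω))).1]
  have hYb : ∀ᵐ ω ∂μ, ∀ t ≤ T, |Y t ω| ≤ C := by
    filter_upwards [hup, hlow] with ω h1 h2 t ht
    exact abs_le.2 ⟨by linarith [h2 t ht], by linarith [h1 t ht]⟩
  refine ⟨Y, m, ⟨hYc.isOptional hYa, ?_⟩, ⟨hmm, hmc, ?_⟩, hm0, ?_⟩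
  · calc ∫⁻ ω, (⨆ t ∈ Set.Icc (0 : ℝ≥0) T, ‖Y t ω‖ₑ ^ 2) ∂μ
        ≤ ∫⁻ _, ENNReal.ofReal C ^ 2 ∂μ := by
          refine lintegral_mono_ae ?_
          filter_upwards [hYb] with ω hω
          refine iSup₂_le fun t ht => ?_
          gcongr
          rw [← ofReal_norm]
          exact ENNReal.ofReal_le_ofReal (hω t ht.2)
      _ < ∞ := by simp
  · exact MemLp.of_bound (hmm.integrable T).1 R (.of_forall (hR T))
  · filter_upwards [heq, hYb, hPb] with ω h1 h2 h3
    -- With `P` and `Y` both in `[-C, C]`, the clipped and original drivers agree along the path.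
    have hdr : Set.EqOn
        (fun s : ℝ => clippedDriver lam C (P s.toNNReal ω) (Y s.toNNReal ω))
        (fun s : ℝ => entropyDriver lam (P s.toNNReal ω) (Y s.toNNReal ω)) (Set.Icc 0 T) := by
      intro s hs
      have hsT : s.toNNReal ≤ T := Real.toNNReal_le_iff_le_coe.2 hs.2
      simp only [clippedDriver, clip_of_abs_le (h2 _ hsT), clip_of_abs_le (h3 _ hsT)]
    refine ⟨(hi ω 0 T).congr fun s hs => ?_, fun t ht => ?_⟩
    · rw [Set.uIoc_of_le T.coe_nonneg] at hs
      exact hdr (Set.Ioc_subset_Icc_self hs)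
    · have htT : (t : ℝ) ≤ T := by exact_mod_cast ht
      rw [h1 t ht, clip_of_abs_le (h3 T le_rfl), intervalIntegral.integral_congr (hdr.mono ?_)]
      rw [Set.uIcc_of_le htT]
      exact Set.Icc_subset_Icc_left t.coe_nonneg

end Main

theorem mainTheorem5 {Ω : Type*} {mΩ : MeasurableSpace Ω}
    (μ : Measure Ω) [IsProbabilityMeasure μ]
    (𝓕 : Filtration ℝ≥0 mΩ) (h𝓕 : UsualConditions 𝓕 μ) (T : ℝ≥0)
    (P : ℝ≥0 → Ω → ℝ) (hP_adapted : StronglyAdapted 𝓕 P) (hP_cadlag : IsCadlag P)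
    (hP_bdd : ∃ C : ℝ, ∀ᵐ ω ∂μ, ∀ t : ℝ≥0, t ≤ T → |P t ω| ≤ C)
    (lam : ℝ) (hlam : lam ∈ Set.Ioc (0 : ℝ) 1) :
    ∃ v m : ℝ≥0 → Ω → ℝ,
      MemS2 𝓕 μ T v ∧ MemM2 𝓕 μ T m ∧ (∀ ω, m 0 ω = 0) ∧
      SolvesEntropyBSDE μ T P lam v m ∧
      ∀ v' m' : ℝ≥0 → Ω → ℝ,
        MemS2 𝓕 μ T v' → MemM2 𝓕 μ T m' → SolvesEntropyBSDE μ T P lam v' m' →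
          ∀ᵐ ω ∂μ, ∀ t : ℝ≥0, t ≤ T →
            v' t ω = v t ω ∧ m' t ω - m' 0 ω = m t ω := by
  obtain ⟨C, hC⟩ := hP_bdd
  -- The given bound may be negative when read as a bare real number, so it is replaced by `max C
  -- 0`.
  obtain ⟨v, m, hv, hm, hm0, hs⟩ := exists_solvesEntropyBSDE (T := T) h𝓕 hP_adapted hP_cadlag
    (le_max_right C 0) (hC.mono fun ω h t ht => (h t ht).trans (le_max_left C 0)) hlam.1
  refine ⟨v, m, hv, hm, hm0, hs, fun v' m' hv' hm' hs' => ?_⟩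
  filter_upwards [hs.ae_unique hlam.1 hv hm hv' hm' hs'] with ω hω t ht
  simpa [hm0 ω] using hω t ht
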